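/- **Setting.** There are $n$ arms $1,\dots,n$. Pulls of arm $i$ return i.i.d. rewards from a distribution with mean $\mu_i\in[0,1]$ that is $1$-sub-Gaussian, $\mathbb E\,e^{s(X-\mu_i)}\le e^{s^2/2}$ for all $s\in\mathbb R$; rewards of different arms are independent. The arms are labelled so that $\mu_1>\mu_2\ge\dots\ge\mu_n$, and $\Delta_i=\mu_1-\mu_i$ for $i\ge2$. The scaling function $\lambda:\mathbb R_+\to\mathbb R_+$ is increasing and concave with $\lambda(0)=0$ and range $\mathbb R_+$; executing $m$ pulls in parallel takes time $\lambda(m)$. Let $\delta\in(0,1)$, $\beta\in(1,n]$ and $\omega=\sqrt{\delta/(6n)}$. **Algorithm (Adaptive Parallel Racing).** Start with $S_1=\{1,\dots,n\}$. For $r=1,2,\dots$, while $|S_r|>1$: put $t_r=\beta^{r-1}\lambda(n)$ and $q_r=\lfloor\lambda^{-1}(t_r)/|S_r|\rfloor$, and pull every arm of $S_r$ exactly $q_r$ times in parallel, which takes time $\lambda(|S_r|q_r)$. For $i \in S_r$ let $N_i$ be the number of pulls of arm $i$ so far, $\hat\mu_i$ the empirical mean of all its rewards so far, and $$L_i=\hat\mu_i-D(N_i),\quad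 U_i=\hat\mu_i+D(N_i),\quad D(N)=\sqrt{\frac{4\log(\log_2(2N)/\omega)}{N}}.$$ Put $S_{r+1}=S_r\setminus\{i\in S_r: U_i<\max_{j\in S_r}L_j\}$. When a single arm survives, stop and output it. The total execution time $T$ is the sum of the times $\lambda(|S_r|q_r)$ over the rounds played. **Dynamic program.** For $z_2\ge\dots\ge z_n$ put $z_{n+1}=0$, $\mathcal T_{n+1}=0$ and, for $j=n,\dots,2$, $$\mathcal T_j(\{z_i\}_{i=j}^n)=\min_{k\in\{j,\dots,n\}}\Big(\lambda\big(k(z_j-z_{k+1})\big)+\mathcal T_{k+1}(\{z_i\}_{i=k+1}^n)\Big).$$ Let $T^\star=\mathcal T_2(\{\Delta_i^{-2}\}_{i=2}^n)$ and $\bar N_i=1+\big\lfloor64\Delta_i^{-2}\log\big(\tfrac2\omega\log_2(192\Delta_i^{-2}/\omega)\big)\big\rfloor$. **Theorem.** With probability at least $1-\delta$, the algorithm stops and outputs the best arm $1$, and its total execution time $T$ satisfies $$T\le 4\,\frac{\beta^{3+4\sqrt{\log_\beta n}}}{\beta-1}\,\mathcal T_2\big(\{\bar N_i\}_{i=2}^n\big).$$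 Moreover $$4\,\frac{\beta^{3+4\sqrt{\log_\beta n}}}{\beta-1}\,\mathcal T_2\big(\{\bar N_i\}_{i=2}^n\big)\le 512\,\frac{\beta^{3+4\sqrt{\log_\beta n}}}{\beta-1}\left(\log\Big(\frac2\omega\log_2\frac{192}{\Delta_2^2\,\omega}\Big)\vee\frac1{64}\right)T^\star .$$ -/

import Mathlib

open MeasureTheory ProbabilityTheory

noncomputable section

namespace APR

/-- Scaling functions `λ : ℝ₊ → ℝ₊`: `lam m` is the time needed to execute `m` pulls when the
whole resource is divided evenly among them. Only the values on `[0, ∞)` matter. -/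
structure IsScalingFunction (lam : ℝ → ℝ) : Prop where
  monotoneOn : MonotoneOn lam (Set.Ici 0)
  map_zero : lam 0 = 0
  image_eq : lam '' Set.Ici 0 = Set.Ici 0
  concaveOn : ConcaveOn ℝ (Set.Ici 0) lam

/-- The inverse `λ⁻¹ : ℝ₊ → ℝ₊` of the scaling function (a scaling function is a bijection
of `[0, ∞)`: being concave, monotone and unbounded, it is strictly increasing). -/
def invScaling (lam : ℝ → ℝ) (t : ℝ) : ℝ :=
  Function.invFunOn lam (Set.Ici 0) t

/-! ### The algorithm

Arms are labelled `1, …, n`. A reward table `x` lists, for each arm `i`, the rewards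
`x i 0, x i 1, …` that its successive pulls return: if arm `i` has been pulled `N` times before a
round, the pulls of that round return `x i N, x i (N + 1), …`. -/

/-- Half-width `D(N, ω) = √(4 log(log₂(2N) / ω) / N)` of the confidence interval. -/
def confWidth (N : ℕ) (ω : ℝ) : ℝ :=
  √(4 * Real.log (Real.logb 2 (2 * N) / ω) / N)

/-- The confidence parameter `ω = √(δ / (6 n))`. -/
def confParam (n : ℕ) (δ : ℝ) : ℝ := √(δ / (6 * n))

/-- Empirical mean of the first `N` rewards. -/
def empMean (y : ℕ → ℝ) (N : ℕ) : ℝ := (∑ k ∈ Finset.range N, y k) / N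

/-- State of the algorithm between two rounds. -/
structure State where
  /-- the surviving arms -/
  alive : Finset ℕ
  /-- the number of times each arm has been pulled so far -/
  pulls : ℕ → ℕ
  /-- the execution time spent so far -/
  time : ℝ

/-- Lower confidence bound `L_i` of arm `i`, after `N i` pulls. -/
def lcb (n : ℕ) (δ : ℝ) (x : ℕ → ℕ → ℝ) (N : ℕ → ℕ) (i : ℕ) : ℝ :=
  empMean (x i) (N i) - confWidth (N i) (confParam n δ)

/-- Upper confidence bound `U_i` of arm `i`, after `N i` pulls. -/
def ucb (n : ℕ) (δ : ℝ) (x : ℕ → ℕ → ℝ) (N : ℕ → ℕ) (i : ℕ) : ℝ :=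
  empMean (x i) (N i) + confWidth (N i) (confParam n δ)

/-- The number `⌊λ⁻¹(t) / m⌋` of times that each of `m` arms can be pulled in parallel
within time `t`. -/
def pullsPerArm (lam : ℝ → ℝ) (t : ℝ) (m : ℕ) : ℕ := ⌊invScaling lam t / m⌋₊

/-- One round with time allocation `t`: every surviving arm is pulled `q` times, all these pulls
being executed in parallel; then every surviving arm whose upper confidence bound is below the
highest lower confidence bound of a surviving arm is eliminated. -/
def playRound (lam : ℝ → ℝ) (n : ℕ) (δ : ℝ) (x : ℕ → ℕ → ℝ) (t : ℝ) (s : State) : State :=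
  let q : ℕ := pullsPerArm lam t s.alive.card
  let N : ℕ → ℕ := fun i => if i ∈ s.alive then s.pulls i + q else s.pulls i
  { alive := {i ∈ s.alive | ¬ ∃ j ∈ s.alive, ucb n δ x N i < lcb n δ x N j}
    pulls := N
    time := s.time + lam (s.alive.card * q) }

/-- The state after `r` rounds. Round `r + 1` is allocated time `β ^ r * λ(n)`, and rounds are
played as long as more than one arm survives; after that the state stays as it is. -/
def run (lam : ℝ → ℝ) (β : ℝ) (n : ℕ) (δ : ℝ) (x : ℕ → ℕ → ℝ) : ℕ → State
  | 0 => { alive := Finset.Icc 1 n, pulls := fun _ => 0, time := 0 }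
  | r + 1 =>
    if 1 < (run lam β n δ x r).alive.card then
      playRound lam n δ x (β ^ r * lam n) (run lam β n δ x r)
    else run lam β n δ x r

/-- The algorithm, run on the reward table `x`, stops, outputs arm `a`, and its total execution
time is `T`. -/
def Returns (lam : ℝ → ℝ) (β : ℝ) (n : ℕ) (δ : ℝ) (x : ℕ → ℕ → ℝ) (a : ℕ) (T : ℝ) : Prop :=
  ∃ r : ℕ, (run lam β n δ x r).alive = {a} ∧ (run lam β n δ x r).time = T

/-! ### The dynamic program and the quantities in the bound -/

/-- The convention `z_{n+1} = 0`. -/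
def extendZero (n : ℕ) (z : ℕ → ℝ) (i : ℕ) : ℝ := if i ≤ n then z i else 0

/-- The dynamic program: `𝒯_{n+1} = 0` and, for `j ≤ n`,
`𝒯_j = min_{k ∈ {j, …, n}} (λ(k (z_j - z_{k+1})) + 𝒯_{k+1})`, with `z_{n+1} = 0`. -/
def elimTime (lam : ℝ → ℝ) (n : ℕ) (z : ℕ → ℝ) (j : ℕ) : ℝ :=
  if h : j ≤ n then
    (Finset.Icc j n).attach.inf' (by simpa using h) fun k =>
      lam ((k : ℕ) * (extendZero n z j - extendZero n z ((k : ℕ) + 1))) +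
        elimTime lam n z ((k : ℕ) + 1)
  else 0
termination_by n + 1 - j
decreasing_by
  have := Finset.mem_Icc.1 k.2
  omega

/-- The mean of a reward distribution. -/
def mean (ν : Measure ℝ) : ℝ := ∫ y, y ∂ν

/-- The gaps `Δ_1 = μ_1 - μ_2` and `Δ_i = μ_1 - μ_i` for `i ≥ 2`. -/
def gap (ν : ℕ → Measure ℝ) (i : ℕ) : ℝ :=
  if i = 1 then mean (ν 1) - mean (ν 2) else mean (ν 1) - mean (ν i)

/-- `log((2/ω) log₂(192 Δ⁻² / ω))`. -/
def logFactor (ω Δ : ℝ) : ℝ :=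
  Real.log ((2 / ω) * Real.logb 2 (192 * (Δ ^ 2)⁻¹ / ω))

/-- `N̄_i = 1 + ⌊64 Δ_i⁻² log((2/ω) log₂(192 Δ_i⁻² / ω))⌋`, where `ω = √(δ / (6 n))`. -/
def pullBound (n : ℕ) (δ : ℝ) (ν : ℕ → Measure ℝ) (i : ℕ) : ℝ :=
  1 + ⌊64 * (gap ν i ^ 2)⁻¹ * logFactor (confParam n δ) (gap ν i)⌋

/-- `T* = 𝒯_2({Δ_i⁻²}_{i=2}^n)`. -/
def Tstar (lam : ℝ → ℝ) (n : ℕ) (ν : ℕ → Measure ℝ) : ℝ :=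
  elimTime lam n (fun i => (gap ν i ^ 2)⁻¹) 2

end APR

end

/-! Surviving arms always have equal pull counts, so only differences of empirical means at a common
count `N` matter. For arms `i` and `1`, the centred difference times `N` is a sum of independent
`2`-sub-Gaussian terms. A maximal inequality on each dyadic block of `N` and a union over blocks and
arms give an event of probability at least `1 - δ` on which every difference is within `2 D(N)` of
its mean. There arm `1` is never eliminated, and arm `i` does not survive a round that brings the
common count to `N̄_i`, because then `4 D(N) < Δ_i` (`four_mul_confWidth_lt`). Everything after this
event, encoded in `Separates`, is deterministic.

Let `T = 𝒯_2(N̄)` and fix a threshold `θ`. The initial stages of an optimal schedule that pull at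
least `θ` arms reach some level `z_{k+1}`, where `k = 1` or `k < θ`. Since `λ⁻¹` is superadditive,
`θ z_{k+1} ≤ λ⁻¹(T)`. Taking `θ = m / c` for `m` alive arms, a round of length `2cT` gives each of
them `z_{k+1}` pulls, so at most `k` survive (`Balanced.card_playRound_mul_le`). Once the allocation
exceeds `2T`, it grows by `β` per round, hence after `a` rounds the number of arms has dropped by
`β^(0 + 1 + ⋯ + (a - 1))`. About `√(2 log_β n)` such rounds suffice, and the total time is a
geometric sum.

For the second inequality, `N̄_i` is at most a constant times `Δ_i⁻²`. The dynamic program is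
monotone (`elimTime_mono`), which needs an exchange argument because the increments `z_j - z_{k+1}`
are not monotone in `z`, and it grows at most linearly under scaling. -/

namespace APR

/-! ### Maximal inequality for sub-Gaussian sums -/

section MaximalInequality

variable {Ω : Type*} [mΩ : MeasurableSpace Ω] {P : Measure Ω}
  {𝒢 : Filtration ℕ mΩ} {Y : ℕ → Ω → ℝ} {c : NNReal}

theorem measurable_sum_range_succ (hY : ∀ k, Measurable[𝒢 k] (Y k)) (k : ℕ) :
    Measurable[𝒢 k] (fun w => ∑ i ∈ Finset.range (k + 1), Y i w) :=
  Finset.measurable_fun_sum _ fun i hi =>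
    (hY i).mono (𝒢.mono (Nat.lt_succ_iff.1 (Finset.mem_range.1 hi))) le_rfl

/-- Partial sums of sub-Gaussian increments, each independent of the past, are sub-Gaussian. -/
theorem hasSubgaussianMGF_sum_range_succ (hY : ∀ k, Measurable[𝒢 k] (Y k))
    (hind : ∀ k, Indep (MeasurableSpace.comap (Y (k + 1)) inferInstance) (𝒢 k) P)
    (hsub : ∀ k, HasSubgaussianMGF (Y k) c P) (k : ℕ) :
    HasSubgaussianMGF (fun w => ∑ i ∈ Finset.range (k + 1), Y i w) ((k + 1) * c) P := by
  induction k with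
  | zero => simpa using hsub 0
  | succ k ih =>
    have h : IndepFun (fun w => ∑ i ∈ Finset.range (k + 1), Y i w) (Y (k + 1)) P := by
      rw [IndepFun_iff_Indep]
      exact indep_of_indep_of_le_left (hind k).symm (measurable_sum_range_succ hY k).comap_le
    have := ih.add_of_indepFun (hsub (k + 1)) h
    simp_rw [Finset.sum_range_succ _ (k + 1)]
    convert this using 1
    push_cast
    ring

/-- The exponentials of the partial sums of centred increments, each independent of the past,
form a submartingale. -/
theorem submartingale_exp_sum [IsProbabilityMeasure P] (hY : ∀ k, Measurable[𝒢 k] (Y k))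
    (hind : ∀ k, Indep (MeasurableSpace.comap (Y (k + 1)) inferInstance) (𝒢 k) P)
    (hsub : ∀ k, HasSubgaussianMGF (Y k) c P) (hmean : ∀ k, ∫ w, Y k w ∂P = 0) (s : ℝ) :
    Submartingale (fun k w => Real.exp (s * ∑ i ∈ Finset.range (k + 1), Y i w)) 𝒢 P := by
  have hint := fun k => (hasSubgaussianMGF_sum_range_succ hY hind hsub k).integrable_exp_mul s
  have hmeas : ∀ k, Measurable[𝒢 k]
      (fun w => Real.exp (s * ∑ i ∈ Finset.range (k + 1), Y i w)) := fun k =>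
    Real.measurable_exp.comp ((measurable_sum_range_succ hY k).const_mul s)
  refine submartingale_nat (fun k => (hmeas k).stronglyMeasurable) hint fun k => ?_
  have hsplit : (fun w => Real.exp (s * ∑ i ∈ Finset.range (k + 1 + 1), Y i w)) =
      (fun w => Real.exp (s * ∑ i ∈ Finset.range (k + 1), Y i w)) *
        fun w => Real.exp (s * Y (k + 1) w) := by
    funext w
    rw [Pi.mul_apply, ← Real.exp_add, Finset.sum_range_succ _ (k + 1), mul_add]
  -- Centring gives this through `1 + u ≤ exp u`. By independence it is the conditional growth
  -- factor.
  have hge : 1 ≤ ∫ w, Real.exp (s * Y (k + 1) w) ∂P := by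
    have h1 : ∫ w, (1 + s * Y (k + 1) w) ∂P = 1 := by
      rw [integral_add (integrable_const _) ((hsub _).integrable.const_mul s),
        integral_const_mul, hmean]
      simp
    rw [← h1]
    refine integral_mono ((integrable_const _).add ((hsub _).integrable.const_mul s))
      ((hsub _).integrable_exp_mul s) fun w => ?_
    have := Real.add_one_le_exp (s * Y (k + 1) w)
    simp only
    linarith
  have hpull := condExp_mul_of_stronglyMeasurable_left (μ := P) (hmeas k).stronglyMeasurable
    (hsplit ▸ hint (k + 1)) ((hsub (k + 1)).integrable_exp_mul s)
  have hY' : Measurable (Y (k + 1)) := (hY _).mono (𝒢.le _) le_rfl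
  have hcond := condExp_indep_eq (μ := P) (f := fun w => Real.exp (s * Y (k + 1) w))
    hY'.comap_le (𝒢.le k)
    (Real.measurable_exp.comp
      ((comap_measurable (Y (k + 1))).const_mul s)).stronglyMeasurable (hind k)
  rw [hsplit]
  filter_upwards [hpull, hcond] with w h1 h2
  rw [h1, Pi.mul_apply, h2]
  exact le_mul_of_one_le_right (Real.exp_pos _).le hge

/-- Maximal Hoeffding inequality. -/
theorem measure_exists_le_sum_le [IsProbabilityMeasure P] (hY : ∀ k, Measurable[𝒢 k] (Y k))
    (hind : ∀ k, Indep (MeasurableSpace.comap (Y (k + 1)) inferInstance) (𝒢 k) P)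
    (hsub : ∀ k, HasSubgaussianMGF (Y k) c P) (hmean : ∀ k, ∫ w, Y k w ∂P = 0)
    (hc : 0 < c) {a : ℝ} (ha : 0 ≤ a) {M : ℕ} (hM : 0 < M) :
    P {w | ∃ k < M, a ≤ ∑ i ∈ Finset.range (k + 1), Y i w} ≤
      ENNReal.ofReal (Real.exp (-a ^ 2 / (2 * M * c))) := by
  obtain ⟨m, rfl⟩ : ∃ m, M = m + 1 := ⟨M - 1, by omega⟩
  have hc' : (0 : ℝ) < c := hc
  -- The minimiser of the Chernoff exponent `-s a + M c s² / 2`.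
  set s : ℝ := a / ((m + 1 : ℕ) * c) with hs
  have hs0 : 0 ≤ s := by positivity
  obtain ⟨e, he⟩ : ∃ e : NNReal, (e : ℝ) = Real.exp (s * a) :=
    ⟨⟨Real.exp (s * a), (Real.exp_pos _).le⟩, rfl⟩
  have hmax := maximal_ineq (submartingale_exp_sum hY hind hsub hmean s)
    (fun k w => (Real.exp_pos _).le) (ε := e) m
  have hsubset : {w | ∃ k < m + 1, a ≤ ∑ i ∈ Finset.range (k + 1), Y i w} ⊆
      {w | (e : ℝ) ≤
        (Finset.range (m + 1)).sup' Finset.nonempty_range_add_one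
          fun k => Real.exp (s * ∑ i ∈ Finset.range (k + 1), Y i w)} := by
    rintro w ⟨k, hk, hak⟩
    refine le_trans ?_ (Finset.le_sup' (fun k => Real.exp (s * ∑ i ∈ Finset.range (k + 1), Y i w))
      (Finset.mem_range.2 hk))
    rw [he]
    exact Real.exp_le_exp.2 (mul_le_mul_of_nonneg_left hak hs0)
  have hsum := hasSubgaussianMGF_sum_range_succ hY hind hsub m
  have hE : ∫ w in {w | (e : ℝ) ≤
        (Finset.range (m + 1)).sup' Finset.nonempty_range_add_one
          fun k => Real.exp (s * ∑ i ∈ Finset.range (k + 1), Y i w)},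
        Real.exp (s * ∑ i ∈ Finset.range (m + 1), Y i w) ∂P ≤
      Real.exp ((m + 1) * c * s ^ 2 / 2) := by
    refine (setIntegral_le_integral (hsum.integrable_exp_mul s)
      (ae_of_all _ fun w => (Real.exp_pos _).le)).trans ?_
    have := hsum.mgf_le s
    simpa [mgf] using this
  have hfin := (mul_le_mul_right (measure_mono (μ := P) hsubset) _).trans
    (hmax.trans (ENNReal.ofReal_le_ofReal hE))
  have hexp : (e : ENNReal) = ENNReal.ofReal (Real.exp (s * a)) := by
    rw [← he, ENNReal.ofReal_coe_nnreal]
  rw [hexp, mul_comm] at hfin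
  have h0 : ENNReal.ofReal (Real.exp (s * a)) ≠ 0 := by simp [Real.exp_pos]
  rw [← ENNReal.le_div_iff_mul_le (Or.inl h0) (Or.inl ENNReal.ofReal_ne_top),
    ← ENNReal.ofReal_div_of_pos (Real.exp_pos _), ← Real.exp_sub] at hfin
  refine hfin.trans (ENNReal.ofReal_le_ofReal (Real.exp_le_exp.2 (le_of_eq ?_)))
  rw [hs]
  push_cast
  field_simp
  ring

end MaximalInequality

/-! ### Time-uniform deviations over dyadic blocks -/

theorem tsum_ofReal_sq_div_le (ω : ℝ) :
    ∑' k : ℕ, ENNReal.ofReal ((ω / (k + 1)) ^ 2) ≤ ENNReal.ofReal (2 * ω ^ 2) := by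
  have h1 : HasSum (fun k : ℕ => 1 / ((k : ℝ) + 1) ^ 2) (Real.pi ^ 2 / 6) := by
    have h := (hasSum_nat_add_iff' 1).2 hasSum_zeta_two
    simpa using h
  have h2 : HasSum (fun k : ℕ => (ω / ((k : ℝ) + 1)) ^ 2) (ω ^ 2 * (Real.pi ^ 2 / 6)) := by
    simpa only [div_pow, mul_one_div] using h1.mul_left (ω ^ 2)
  rw [← ENNReal.ofReal_tsum_of_nonneg (fun k => sq_nonneg _) h2.summable, h2.tsum_eq]
  refine ENNReal.ofReal_le_ofReal ?_
  have hpi : Real.pi ^ 2 / 6 ≤ 2 := by nlinarith [Real.pi_lt_d2, Real.pi_pos]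
  nlinarith [sq_nonneg ω]

theorem succ_le_logb_two_mul {k N : ℕ} (h : 2 ^ k ≤ N) : (k : ℝ) + 1 ≤ Real.logb 2 (2 * N) := by
  have h2 : (2 : ℝ) ^ (k + 1) ≤ 2 * N := by
    rw [pow_succ, mul_comm]
    exact mul_le_mul_of_nonneg_left (by exact_mod_cast h) (by norm_num)
  rw [Real.le_logb_iff_rpow_le (by norm_num) (lt_of_lt_of_le (by positivity) h2)]
  exact_mod_cast h2

theorem log_div_nonneg {ω x : ℝ} (hω : 0 < ω) (hω1 : ω ≤ 1) (hx : 1 ≤ x) :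
    0 ≤ Real.log (x / ω) :=
  Real.log_nonneg ((one_le_div hω).2 (hω1.trans hx))

/-- The boundary `2 N D(N) = √(16 N log(log₂(2N) / ω))` increases with `N`, so on the block starting
at `2 ^ k` one constant threshold lies below it and the maximal inequality applies. -/
theorem sqrt_le_two_mul_mul_confWidth {k N : ℕ} {ω : ℝ} (hω : 0 < ω) (hω1 : ω ≤ 1)
    (h : 2 ^ k ≤ N) :
    √(16 * (2 ^ k * Real.log (((k : ℝ) + 1) / ω))) ≤ 2 * N * confWidth N ω := by
  have hN : (0 : ℝ) < N := by exact_mod_cast (Nat.two_pow_pos k).trans_le h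
  have hlog := succ_le_logb_two_mul h
  have hconf : 2 * N * confWidth N ω =
      √((2 * N) ^ 2 * (4 * Real.log (Real.logb 2 (2 * N) / ω) / N)) := by
    rw [Real.sqrt_mul (sq_nonneg _), Real.sqrt_sq (by positivity), confWidth]
  rw [hconf]
  refine Real.sqrt_le_sqrt ?_
  have h1 : Real.log (((k : ℝ) + 1) / ω) ≤ Real.log (Real.logb 2 (2 * N) / ω) :=
    Real.log_le_log (by positivity) (by gcongr)
  have h2 : (2 : ℝ) ^ k ≤ N := by exact_mod_cast h
  have h3 : 0 ≤ Real.log (((k : ℝ) + 1) / ω) :=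
    log_div_nonneg hω hω1 (by linarith [Nat.cast_nonneg (α := ℝ) k])
  calc 16 * (2 ^ k * Real.log (((k : ℝ) + 1) / ω))
      ≤ 16 * (N * Real.log (Real.logb 2 (2 * N) / ω)) := by gcongr
    _ = (2 * N) ^ 2 * (4 * Real.log (Real.logb 2 (2 * N) / ω) / N) := by
      field_simp
      ring

section Concentration

variable {Ω : Type*} [mΩ : MeasurableSpace Ω] {P : Measure Ω} {ι : Type*}

/-- The information contained in the first `k + 1` members of every sequence. -/
def pastFiltration (X : ι × ℕ → Ω → ℝ) (hX : ∀ p, Measurable (X p)) : Filtration ℕ mΩ where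
  seq k := ⨆ p ∈ {p : ι × ℕ | p.2 ≤ k}, MeasurableSpace.comap (X p) inferInstance
  mono' _ _ hkl := biSup_mono fun _ hp => le_trans hp hkl
  le' _ := iSup₂_le fun p _ => (hX p).comap_le

theorem measurable_sub_pastFiltration (X : ι × ℕ → Ω → ℝ) (hX : ∀ p, Measurable (X p))
    (i j : ι) (k : ℕ) :
    Measurable[pastFiltration X hX k] (fun w => X (i, k) w - X (j, k) w) := by
  have h : ∀ i : ι, Measurable[pastFiltration X hX k] (X (i, k)) := fun i =>
    Measurable.of_comap_le (le_iSup₂_of_le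
      (f := fun (p : ι × ℕ) (_ : p ∈ {p : ι × ℕ | p.2 ≤ k}) =>
        MeasurableSpace.comap (X p) inferInstance) (i, k) (le_refl k) le_rfl)
  exact (h i).sub (h j)

theorem indep_sub_pastFiltration (X : ι × ℕ → Ω → ℝ) (hX : ∀ p, Measurable (X p))
    (hind : iIndepFun X P) (i j : ι) (k : ℕ) :
    Indep (MeasurableSpace.comap (fun w => X (i, k + 1) w - X (j, k + 1) w) inferInstance)
      (pastFiltration X hX k) P := by
  have h := indep_iSup_of_disjoint (S := {p : ι × ℕ | p.2 = k + 1}) (T := {p | p.2 ≤ k})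
    (fun p => (hX p).comap_le) hind
    (Set.disjoint_left.2 fun p (h1 : p.2 = k + 1) (h2 : p.2 ≤ k) => by omega)
  refine indep_of_indep_of_le_left h ?_
  have hm : ∀ i : ι, Measurable[⨆ p ∈ {p : ι × ℕ | p.2 = k + 1},
      MeasurableSpace.comap (X p) inferInstance] (X (i, k + 1)) := fun i =>
    Measurable.of_comap_le (le_iSup₂_of_le
      (f := fun (p : ι × ℕ) (_ : p ∈ {p : ι × ℕ | p.2 = k + 1}) =>
        MeasurableSpace.comap (X p) inferInstance) (i, k + 1) rfl le_rfl)
  exact ((hm i).sub (hm j)).comap_le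

/-- Time-uniform deviation bound for the difference of two independent sequences of independent
centred `1`-sub-Gaussian variables. -/
theorem measure_exists_confWidth_lt_le [IsProbabilityMeasure P] (X : ι × ℕ → Ω → ℝ)
    (hX : ∀ p, Measurable (X p)) (hind : iIndepFun X P)
    (hsub : ∀ p, HasSubgaussianMGF (X p) 1 P) (hmean : ∀ p, ∫ w, X p w ∂P = 0)
    {i j : ι} (hij : i ≠ j) {ω : ℝ} (hω : 0 < ω) (hω1 : ω ≤ 1) :
    P {w | ∃ N : ℕ, 0 < N ∧
        2 * N * confWidth N ω < ∑ l ∈ Finset.range N, (X (i, l) w - X (j, l) w)} ≤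
      ENNReal.ofReal (2 * ω ^ 2) := by
  have hsub' : ∀ l, HasSubgaussianMGF (fun w => X (i, l) w - X (j, l) w) 2 P := fun l => by
    have := (hsub (i, l)).sub_of_indepFun (hsub (j, l))
      (hind.indepFun (by simpa using hij : (i, l) ≠ (j, l)))
    rwa [one_add_one_eq_two] at this
  have hmean' : ∀ l, ∫ w, (X (i, l) w - X (j, l) w) ∂P = 0 := fun l => by
    rw [integral_sub (hsub _).integrable (hsub _).integrable, hmean, hmean, sub_zero]
  have hk : ∀ k : ℕ, P {w | ∃ m < 2 ^ (k + 1), √(16 * (2 ^ k * Real.log (((k : ℝ) + 1) / ω))) ≤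
        ∑ l ∈ Finset.range (m + 1), (X (i, l) w - X (j, l) w)} ≤
      ENNReal.ofReal ((ω / (k + 1)) ^ 2) := fun k => by
    refine (measure_exists_le_sum_le (measurable_sub_pastFiltration X hX i j)
      (indep_sub_pastFiltration X hX hind i j) hsub' hmean' two_pos (Real.sqrt_nonneg _)
      (by positivity)).trans (ENNReal.ofReal_le_ofReal (le_of_eq ?_))
    have h3 : 0 ≤ Real.log (((k : ℝ) + 1) / ω) :=
      log_div_nonneg hω hω1 (by linarith [Nat.cast_nonneg (α := ℝ) k])
    rw [Real.sq_sqrt (by positivity)]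
    -- With block end `2 ^ (k + 1)` and variance proxy `2`, the exponent is `-2 log((k + 1) / ω)`.
    -- The constant `4` in `D` thus makes the failure probabilities summable.
    have : -(16 * (2 ^ k * Real.log (((k : ℝ) + 1) / ω))) /
        (2 * ((2 ^ (k + 1) : ℕ) : ℝ) * ((2 : NNReal) : ℝ)) =
        Real.log ((ω / (k + 1)) ^ 2) := by
      rw [Real.log_pow, ← inv_div ((k : ℝ) + 1) ω, Real.log_inv]
      push_cast
      field_simp
      ring
    rw [this, Real.exp_log (by positivity)]
  refine (measure_mono ?_).trans ((measure_iUnion_le _).trans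
    ((ENNReal.tsum_le_tsum hk).trans (tsum_ofReal_sq_div_le ω)))
  rintro w ⟨N, hN, hw⟩
  -- The maximal inequality indexes the sum of `N` terms by `N - 1`.
  refine Set.mem_iUnion.2 ⟨Nat.log 2 N, N - 1, ?_, ?_⟩
  · have := Nat.lt_pow_succ_log_self one_lt_two N
    omega
  · rw [Nat.sub_add_cancel hN]
    exact (sqrt_le_two_mul_mul_confWidth hω hω1 (Nat.pow_log_le_self 2 hN.ne')).trans hw.le

end Concentration

/-! ### Scaling functions and their inverses -/

namespace IsScalingFunction

variable {lam : ℝ → ℝ}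

theorem nonneg (h : IsScalingFunction lam) {x : ℝ} (hx : 0 ≤ x) : 0 ≤ lam x := by
  simpa [h.map_zero] using h.monotoneOn (Set.mem_Ici.2 le_rfl) hx hx

theorem strictMonoOn (h : IsScalingFunction lam) : StrictMonoOn lam (Set.Ici 0) := by
  intro x hx y hy hxy
  -- Unboundedness supplies a later point with positive slope from `y`; by concavity the slope
  -- before `y` is at least as large.
  obtain ⟨z, hz, hzy⟩ : lam y + 1 ∈ lam '' Set.Ici 0 := by
    rw [h.image_eq]
    exact add_nonneg (h.nonneg hy) zero_le_one
  have hyz : y < z := by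
    by_contra! hle
    linarith [h.monotoneOn hz hy hle]
  have hslope := h.concaveOn.slope_anti_adjacent hx hz hxy hyz
  rw [hzy, add_sub_cancel_left] at hslope
  have h1 : 0 < (lam y - lam x) / (y - x) :=
    (div_pos one_pos (sub_pos.2 hyz)).trans_le hslope
  exact sub_pos.1 ((div_pos_iff_of_pos_right (sub_pos.2 hxy)).1 h1)

theorem map_mul_le (h : IsScalingFunction lam) {c x : ℝ} (hc : 1 ≤ c) (hx : 0 ≤ x) :
    lam (c * x) ≤ c * lam x := by
  have hc0 : 0 < c := one_pos.trans_le hc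
  have := h.concaveOn.2 (Set.mem_Ici.2 (mul_nonneg hc0.le hx)) (Set.mem_Ici.2 (le_refl (0 : ℝ)))
    (inv_nonneg.2 hc0.le) (sub_nonneg.2 (inv_le_one_of_one_le₀ hc)) (by ring)
  simp only [smul_eq_mul, h.map_zero, mul_zero, add_zero, inv_mul_cancel_left₀ hc0.ne'] at this
  rwa [inv_mul_le_iff₀ hc0] at this

theorem map_add_le (h : IsScalingFunction lam) {x y : ℝ} (hx : 0 ≤ x) (hy : 0 ≤ y) :
    lam (x + y) ≤ lam x + lam y := by
  rcases hx.eq_or_lt with rfl | hx'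
  · simp [h.map_zero]
  rcases hy.eq_or_lt with rfl | hy'
  · simp [h.map_zero]
  have h1 := h.map_mul_le (c := (x + y) / x) ((one_le_div hx').2 (by linarith)) hx
  have h2 := h.map_mul_le (c := (x + y) / y) ((one_le_div hy').2 (by linarith)) hy
  rw [div_mul_cancel₀ _ hx'.ne', div_mul_eq_mul_div, le_div_iff₀ hx'] at h1
  rw [div_mul_cancel₀ _ hy'.ne', div_mul_eq_mul_div, le_div_iff₀ hy'] at h2
  have hxy : 0 < x + y := add_pos hx' hy'
  refine le_of_mul_le_mul_left ?_ hxy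
  linarith

theorem invScaling_nonneg (h : IsScalingFunction lam) {t : ℝ} (ht : 0 ≤ t) :
    0 ≤ invScaling lam t :=
  Function.invFunOn_mem (h.image_eq.symm ▸ ht : t ∈ lam '' Set.Ici 0)

theorem map_invScaling (h : IsScalingFunction lam) {t : ℝ} (ht : 0 ≤ t) :
    lam (invScaling lam t) = t :=
  Function.invFunOn_eq (h.image_eq.symm ▸ ht : t ∈ lam '' Set.Ici 0)

theorem le_invScaling_iff (h : IsScalingFunction lam) {x t : ℝ} (hx : 0 ≤ x) (ht : 0 ≤ t) :
    x ≤ invScaling lam t ↔ lam x ≤ t := by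
  conv_rhs => rw [← h.map_invScaling ht]
  exact (h.strictMonoOn.le_iff_le hx (h.invScaling_nonneg ht)).symm

theorem invScaling_map (h : IsScalingFunction lam) {x : ℝ} (hx : 0 ≤ x) :
    invScaling lam (lam x) = x :=
  h.strictMonoOn.injOn (h.invScaling_nonneg (h.nonneg hx)) hx (h.map_invScaling (h.nonneg hx))

theorem invScaling_mono (h : IsScalingFunction lam) {s t : ℝ} (hs : 0 ≤ s) (hst : s ≤ t) :
    invScaling lam s ≤ invScaling lam t := by
  rwa [h.le_invScaling_iff (h.invScaling_nonneg hs) (hs.trans hst), h.map_invScaling hs]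

theorem add_invScaling_le (h : IsScalingFunction lam) {s t : ℝ} (hs : 0 ≤ s) (ht : 0 ≤ t) :
    invScaling lam s + invScaling lam t ≤ invScaling lam (s + t) := by
  have h1 := h.invScaling_nonneg hs
  have h2 := h.invScaling_nonneg ht
  rw [h.le_invScaling_iff (add_nonneg h1 h2) (add_nonneg hs ht)]
  simpa only [h.map_invScaling hs, h.map_invScaling ht] using h.map_add_le h1 h2

theorem mul_invScaling_le (h : IsScalingFunction lam) {c t : ℝ} (hc : 1 ≤ c) (ht : 0 ≤ t) :
    c * invScaling lam t ≤ invScaling lam (c * t) := by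
  have hc0 : 0 ≤ c := zero_le_one.trans hc
  have h1 := h.invScaling_nonneg ht
  rw [h.le_invScaling_iff (mul_nonneg hc0 h1) (mul_nonneg hc0 ht)]
  simpa only [h.map_invScaling ht] using h.map_mul_le hc h1

end IsScalingFunction

/-! ### The dynamic program: reachable levels, monotonicity, scaling -/

section DynamicProgram

variable {lam : ℝ → ℝ} {n : ℕ}

theorem extendZero_of_le {z : ℕ → ℝ} {i : ℕ} (h : i ≤ n) : extendZero n z i = z i := if_pos h

theorem extendZero_of_lt {z : ℕ → ℝ} {i : ℕ} (h : n < i) : extendZero n z i = 0 :=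
  if_neg h.not_ge

theorem antitoneOn_extendZero {z : ℕ → ℝ} (hz : AntitoneOn z (Set.Icc 2 n))
    (h0 : ∀ i ∈ Set.Icc 2 n, 0 ≤ z i) : AntitoneOn (extendZero n z) (Set.Ici 2) := by
  intro i (hi : 2 ≤ i) k (hk : 2 ≤ k) hik
  rcases le_or_gt k n with hkn | hkn
  · rw [extendZero_of_le hkn, extendZero_of_le (hik.trans hkn)]
    exact hz ⟨hi, hik.trans hkn⟩ ⟨hk, hkn⟩ hik
  · rw [extendZero_of_lt hkn]
    rcases le_or_gt i n with hin | hin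
    · rw [extendZero_of_le hin]
      exact h0 i ⟨hi, hin⟩
    · rw [extendZero_of_lt hin]

theorem elimTime_of_lt (z : ℕ → ℝ) {j : ℕ} (h : n < j) : elimTime lam n z j = 0 := by
  rw [elimTime, dif_neg h.not_ge]

theorem elimTime_le (z : ℕ → ℝ) {j k : ℕ} (hjk : j ≤ k) (hk : k ≤ n) :
    elimTime lam n z j ≤
      lam (k * (extendZero n z j - extendZero n z (k + 1))) + elimTime lam n z (k + 1) := by
  rw [elimTime, dif_pos (hjk.trans hk)]
  exact Finset.inf'_le
    (fun k : {x // x ∈ Finset.Icc j n} =>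
      lam ((k : ℕ) * (extendZero n z j - extendZero n z ((k : ℕ) + 1))) +
        elimTime lam n z ((k : ℕ) + 1))
    (Finset.mem_attach _ (⟨k, Finset.mem_Icc.2 ⟨hjk, hk⟩⟩ : {x // x ∈ Finset.Icc j n}))

theorem exists_elimTime_eq (lam : ℝ → ℝ) (z : ℕ → ℝ) {j : ℕ} (hj : j ≤ n) :
    ∃ k, j ≤ k ∧ k ≤ n ∧ elimTime lam n z j =
      lam (k * (extendZero n z j - extendZero n z (k + 1))) + elimTime lam n z (k + 1) := by
  rw [elimTime, dif_pos hj]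
  obtain ⟨k, -, hk⟩ := Finset.exists_mem_eq_inf' (s := (Finset.Icc j n).attach) (by simpa using hj)
    (fun k : {x // x ∈ Finset.Icc j n} =>
      lam ((k : ℕ) * (extendZero n z j - extendZero n z ((k : ℕ) + 1))) +
        elimTime lam n z ((k : ℕ) + 1))
  exact ⟨k, (Finset.mem_Icc.1 k.2).1, (Finset.mem_Icc.1 k.2).2, hk⟩

theorem stage_nonneg {z : ℕ → ℝ} (hz : AntitoneOn (extendZero n z) (Set.Ici 2)) {j k : ℕ}
    (hj : 2 ≤ j) (hjk : j ≤ k) : 0 ≤ k * (extendZero n z j - extendZero n z (k + 1)) :=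
  mul_nonneg k.cast_nonneg (sub_nonneg.2
    (hz hj (Set.mem_Ici.2 (by omega : 2 ≤ k + 1)) (by omega : j ≤ k + 1)))

theorem elimTime_nonneg (hlam : IsScalingFunction lam) {z : ℕ → ℝ}
    (hz : AntitoneOn (extendZero n z) (Set.Ici 2)) {j : ℕ} (hj : 2 ≤ j) :
    0 ≤ elimTime lam n z j := by
  induction hd : n + 1 - j using Nat.strong_induction_on generalizing j with
  | _ d ih =>
    rcases le_or_gt j n with hjn | hjn
    · obtain ⟨k, hjk, hkn, hk⟩ := exists_elimTime_eq lam z hjn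
      rw [hk]
      exact add_nonneg (hlam.nonneg (stage_nonneg hz hj hjk))
        (ih (n + 1 - (k + 1)) (by omega) (by omega) rfl)
    · rw [elimTime_of_lt z hjn]

/-- Within time `elimTime`, some level `z_{k+1}` can be reached while pulling `θ` arms in
parallel, where all later stages of the optimal schedule involve fewer than `θ` arms. -/
theorem exists_mul_le_invScaling_elimTime (hlam : IsScalingFunction lam) {z : ℕ → ℝ}
    (hz : AntitoneOn (extendZero n z) (Set.Ici 2)) {θ : ℝ} {m : ℕ} (hm : 1 ≤ m)
    (hmn : m ≤ n) :
    ∃ k, m ≤ k ∧ k ≤ n ∧ (k = m ∨ (k : ℝ) < θ) ∧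
      θ * extendZero n z (k + 1) ≤ invScaling lam (elimTime lam n z (m + 1)) := by
  induction hd : n - m using Nat.strong_induction_on generalizing m with
  | _ d ih =>
    rcases hmn.eq_or_lt with rfl | hlt
    · refine ⟨m, le_rfl, le_rfl, Or.inl rfl, ?_⟩
      rw [extendZero_of_lt (Nat.lt_succ_self m), mul_zero]
      exact hlam.invScaling_nonneg (elimTime_nonneg hlam hz (by omega))
    · obtain ⟨k, hjk, hkn, hk⟩ := exists_elimTime_eq lam z (Nat.succ_le_of_lt hlt)
      obtain ⟨k', hkk', hk'n, hor, hle⟩ := ih (n - k) (by omega) (by omega) hkn rfl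
      have hT := elimTime_nonneg hlam hz (by omega : 2 ≤ k + 1)
      have hst := stage_nonneg hz (by omega : 2 ≤ m + 1) hjk
      rw [hk]
      have hmono : invScaling lam (elimTime lam n z (k + 1)) ≤
          invScaling lam (lam (k * (extendZero n z (m + 1) - extendZero n z (k + 1))) +
            elimTime lam n z (k + 1)) :=
        hlam.invScaling_mono hT (by linarith [hlam.nonneg hst])
      rcases lt_or_ge (k' : ℝ) θ with hlt' | hge'
      · exact ⟨k', by omega, hk'n, Or.inr hlt', hle.trans hmono⟩
      -- The stage of `k` arms that follows level `z_{k+1}` also pulls at least `θ` arms, so its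
      -- work adds to that already counted and the level rises to `z_{m+1}`.
      · obtain rfl : k' = k := hor.resolve_right hge'.not_gt
        refine ⟨m, le_rfl, hmn, Or.inl rfl, ?_⟩
        have hadd := hlam.add_invScaling_le (hlam.nonneg hst) hT
        rw [hlam.invScaling_map hst] at hadd
        have hd0 : 0 ≤ extendZero n z (m + 1) - extendZero n z (k' + 1) :=
          sub_nonneg.2 (hz (Set.mem_Ici.2 (by omega : 2 ≤ m + 1))
            (Set.mem_Ici.2 (by omega : 2 ≤ k' + 1)) (by omega))
        have := mul_le_mul_of_nonneg_right hge' hd0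
        linarith

/-- Levels of `w` below those of `z` can be reached at least as fast, from any common starting
level `y`. -/
theorem exists_stage_le_stage (hlam : IsScalingFunction lam) {w z : ℕ → ℝ}
    (hw : AntitoneOn (extendZero n w) (Set.Ici 2)) (hz : AntitoneOn (extendZero n z) (Set.Ici 2))
    (hwz : ∀ i, 2 ≤ i → extendZero n w i ≤ extendZero n z i) {j : ℕ} (hj : 2 ≤ j) {y : ℝ}
    (hy : extendZero n z j ≤ y) {k : ℕ} (hjk : j ≤ k) (hkn : k ≤ n) :
    ∃ l, j ≤ l ∧ l ≤ n ∧
      lam (l * (y - extendZero n w (l + 1))) + elimTime lam n w (l + 1) ≤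
        lam (k * (y - extendZero n z (k + 1))) + elimTime lam n z (k + 1) := by
  induction hd : n - j using Nat.strong_induction_on generalizing j k y with
  | _ d ih =>
    rcases hkn.eq_or_lt with rfl | hkn'
    · refine ⟨k, hjk, le_rfl, ?_⟩
      rw [extendZero_of_lt (Nat.lt_succ_self k), extendZero_of_lt (Nat.lt_succ_self k),
        elimTime_of_lt w (Nat.lt_succ_self k), elimTime_of_lt z (Nat.lt_succ_self k)]
    · obtain ⟨l', hkl', hl'n, hl'⟩ := exists_elimTime_eq lam z (Nat.succ_le_of_lt hkn')
      obtain ⟨l, hkl, hln, hl⟩ := ih (n - (k + 1)) (by omega) (by omega) le_rfl hkl' hl'n rfl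
      rw [← hl'] at hl
      set W := extendZero n w (k + 1)
      set V := extendZero n w (l + 1)
      set y' := extendZero n z (k + 1)
      have hWy' : W ≤ y' := hwz _ (by omega)
      have hy'y : y' ≤ y := (hz hj (Set.mem_Ici.2 (by omega : 2 ≤ k + 1)) (by omega)).trans hy
      have hVW : V ≤ W := hw (Set.mem_Ici.2 (by omega : 2 ≤ k + 1))
        (Set.mem_Ici.2 (by omega : 2 ≤ l + 1)) (by omega)
      -- Two `w`-schedules compete: from `y` to `V` with `l` arms at once, or `k` arms down to `W`
      -- and `l` arms on to `V`. Writing `y' = a W + b y`, concavity bounds their average with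
      -- weights `b` and `a` by the cost of passing through `y'`, so one of them is no slower.
      obtain ⟨a, b, ha, hb, hab, hcomb⟩ : y' ∈ segment ℝ W y := by
        rw [segment_eq_Icc (hWy'.trans hy'y)]
        exact ⟨hWy', hy'y⟩
      simp only [smul_eq_mul] at hcomb
      have h1 := hlam.concaveOn.2
        (Set.mem_Ici.2 (mul_nonneg k.cast_nonneg (by linarith) : (0 : ℝ) ≤ k * (y - W)))
        (Set.mem_Ici.2 le_rfl) ha hb hab
      have h2 := hlam.concaveOn.2
        (Set.mem_Ici.2 (mul_nonneg l.cast_nonneg (by linarith) : (0 : ℝ) ≤ l * (W - V)))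
        (Set.mem_Ici.2 (mul_nonneg l.cast_nonneg (by linarith) : (0 : ℝ) ≤ l * (y - V)))
        ha hb hab
      have e1 : a * (k * (y - W)) = k * (y - y') := by
        rw [← hcomb]
        linear_combination ((k : ℝ) * y) * hab
      have e2 : a * (l * (W - V)) + b * (l * (y - V)) = l * (y' - V) := by
        rw [← hcomb]
        linear_combination (-(l : ℝ) * V) * hab
      simp only [smul_eq_mul, hlam.map_zero, mul_zero, add_zero, e1] at h1
      simp only [smul_eq_mul, e2] at h2
      have h3 := elimTime_le (lam := lam) w hkl hln
      by_contra! hcon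
      have c1 := hcon l (by omega) hln
      have c2 := hcon k hjk hkn
      have : a * (lam (k * (y - W)) + lam (l * (W - V))) + b * lam (l * (y - V)) ≤
          lam (k * (y - y')) + lam (l * (y' - V)) := by linarith
      have c1' : lam (k * (y - y')) + lam (l * (y' - V)) < lam (l * (y - V)) := by linarith
      have c2' : lam (k * (y - y')) + lam (l * (y' - V)) <
          lam (k * (y - W)) + lam (l * (W - V)) := by linarith
      obtain rfl : b = 1 - a := by linarith
      rcases ha.eq_or_lt with rfl | ha'
      · linarith
      · have := mul_lt_mul_of_pos_left c2' ha'
        have := mul_le_mul_of_nonneg_left c1'.le hb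
        linarith

theorem elimTime_mono (hlam : IsScalingFunction lam) {w z : ℕ → ℝ}
    (hw : AntitoneOn (extendZero n w) (Set.Ici 2)) (hz : AntitoneOn (extendZero n z) (Set.Ici 2))
    (hwz : ∀ i, 2 ≤ i → extendZero n w i ≤ extendZero n z i) {j : ℕ} (hj : 2 ≤ j) :
    elimTime lam n w j ≤ elimTime lam n z j := by
  rcases le_or_gt j n with hjn | hjn
  · obtain ⟨k, hjk, hkn, hk⟩ := exists_elimTime_eq lam z hjn
    obtain ⟨l, hjl, hln, hl⟩ := exists_stage_le_stage hlam hw hz hwz hj le_rfl hjk hkn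
    rw [hk]
    refine (elimTime_le w hjl hln).trans (le_trans ?_ hl)
    have hst := stage_nonneg hw hj hjl
    have hle : (l : ℝ) * (extendZero n w j - extendZero n w (l + 1)) ≤
        l * (extendZero n z j - extendZero n w (l + 1)) :=
      mul_le_mul_of_nonneg_left (by linarith [hwz j hj]) l.cast_nonneg
    linarith [hlam.monotoneOn hst (Set.mem_Ici.2 (hst.trans hle)) hle]
  · rw [elimTime_of_lt w hjn, elimTime_of_lt z hjn]

theorem extendZero_const_mul (c : ℝ) (z : ℕ → ℝ) (i : ℕ) :
    extendZero n (fun i => c * z i) i = c * extendZero n z i := by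
  simp [extendZero]

theorem elimTime_const_mul_le (hlam : IsScalingFunction lam) {z : ℕ → ℝ}
    (hz : AntitoneOn (extendZero n z) (Set.Ici 2)) {c : ℝ} (hc : 1 ≤ c) {j : ℕ} (hj : 2 ≤ j) :
    elimTime lam n (fun i => c * z i) j ≤ c * elimTime lam n z j := by
  induction hd : n + 1 - j using Nat.strong_induction_on generalizing j with
  | _ d ih =>
    rcases le_or_gt j n with hjn | hjn
    · obtain ⟨k, hjk, hkn, hk⟩ := exists_elimTime_eq lam z hjn
      refine (elimTime_le _ hjk hkn).trans ?_
      rw [hk, extendZero_const_mul, extendZero_const_mul, ← mul_sub, mul_left_comm, mul_add]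
      exact add_le_add (hlam.map_mul_le hc (stage_nonneg hz hj hjk))
        (ih (n + 1 - (k + 1)) (by omega) (by omega) rfl)
    · rw [elimTime_of_lt _ hjn, elimTime_of_lt _ hjn, mul_zero]

end DynamicProgram

/-! ### Inverting the confidence width -/

/-- Resolves the implicit condition on `N` hidden in `log₂(2N)`. As `ω log(E / ω) ≤ E`, one gets `2N
≤ (3a / ω)(2E / 3)`, and each factor is at most `2 ^ (E / 2)`, the second strictly smaller. -/
theorem two_mul_lt_rpow {a E ω x N : ℝ} (ha : 0 < a) (hω : 0 < ω) (hω1 : ω ≤ 1)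
    (hx : 2 ≤ x) (hax : 3 * a / ω ≤ 2 ^ x) (hE : 2 * x ≤ E) (hN : N = a * Real.log (E / ω)) :
    2 * N < 2 ^ E := by
  have hE4 : 4 ≤ E := by linarith
  have hlog : ω * Real.log (E / ω) ≤ E := by
    rw [Real.log_div (by linarith) hω.ne']
    have h1 := Real.log_le_sub_one_of_pos (show 0 < E by linarith)
    have h2 := Real.log_le_sub_one_of_pos (inv_pos.2 hω)
    rw [Real.log_inv] at h2
    have h3 : ω * (Real.log E - Real.log ω) ≤ ω * ((E - 1) + (ω⁻¹ - 1)) :=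
      mul_le_mul_of_nonneg_left (by linarith) hω.le
    have h4 : ω * ((E - 1) + (ω⁻¹ - 1)) = ω * (E - 2) + 1 := by
      field_simp
      ring
    nlinarith
  have hbern : 1 + E / 4 ≤ (2 : ℝ) ^ (E / 4) := by
    have := one_add_mul_self_le_rpow_one_add (s := 1) (by norm_num) (p := E / 4) (by linarith)
    norm_num at this
    linarith
  have hhalf : 2 * E / 3 < (2 : ℝ) ^ (E / 2) := by
    have : (2 : ℝ) ^ (E / 2) = 2 ^ (E / 4) * 2 ^ (E / 4) := by
      rw [← Real.rpow_add two_pos]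
      ring_nf
    rw [this]
    nlinarith
  have hbase : 3 * a / ω ≤ (2 : ℝ) ^ (E / 2) :=
    hax.trans (Real.rpow_le_rpow_of_exponent_le (by norm_num) (by linarith))
  have hpow : (2 : ℝ) ^ E = 2 ^ (E / 2) * 2 ^ (E / 2) := by
    rw [← Real.rpow_add two_pos]
    ring_nf
  rw [hpow, hN]
  have hc : 0 < 3 * a / ω := by positivity
  calc 2 * (a * Real.log (E / ω)) = (2 * a / ω) * (ω * Real.log (E / ω)) := by field_simp
    _ ≤ (2 * a / ω) * E := by gcongr
    _ = 3 * a / ω * (2 * E / 3) := by ring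
    _ < 3 * a / ω * 2 ^ (E / 2) := by gcongr
    _ ≤ _ := by gcongr

theorem seven_le_logb {ω Δ : ℝ} (hω : 0 < ω) (hω1 : ω ≤ 1) (hΔ : 0 < Δ) (hΔ1 : Δ ≤ 1) :
    7 ≤ Real.logb 2 (192 * (Δ ^ 2)⁻¹ / ω) := by
  have h1 : 1 ≤ (Δ ^ 2)⁻¹ := (one_le_inv₀ (by positivity)).2 (pow_le_one₀ hΔ.le hΔ1)
  have h2 : 192 ≤ 192 * (Δ ^ 2)⁻¹ / ω := by
    rw [le_div_iff₀ hω]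
    nlinarith
  rw [Real.le_logb_iff_rpow_le (by norm_num) (by linarith)]
  have : (2 : ℝ) ^ (7 : ℝ) = 128 := by
    rw [show (7 : ℝ) = (7 : ℕ) by norm_num, Real.rpow_natCast]
    norm_num
  linarith

/-- After `64 Δ⁻² logFactor` pulls the confidence intervals are shorter than `Δ / 2`. -/
theorem four_mul_confWidth_lt {ω Δ : ℝ} (hω : 0 < ω) (hω1 : ω ≤ 1) (hΔ : 0 < Δ) (hΔ1 : Δ ≤ 1)
    {N : ℕ} (hN : 0 < N) (hle : 64 * (Δ ^ 2)⁻¹ * logFactor ω Δ ≤ N) :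
    4 * confWidth N ω < Δ := by
  have hN' : (1 : ℝ) ≤ N := by exact_mod_cast hN
  have hx := seven_le_logb hω hω1 hΔ hΔ1
  set x := Real.logb 2 (192 * (Δ ^ 2)⁻¹ / ω) with hxdef
  set a : ℝ := 64 * (Δ ^ 2)⁻¹ with hadef
  have ha : 0 < a := by positivity
  have hlarge : (2 : ℝ) ^ x = 3 * a / ω := by
    rw [hxdef, Real.rpow_logb two_pos (by norm_num) (by positivity), hadef]
    ring
  -- Chosen so that `N = a log(E / ω)`. The hypothesis on `N` then reads `2x ≤ E`, and `192 = 3 ·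
  -- 64` is the factor `3a` of `two_mul_lt_rpow`.
  set E := ω * Real.exp (N / a) with hEdef
  have hE : 2 * x ≤ E := by
    have h1 : Real.log (2 / ω * x) ≤ N / a := by
      rw [le_div_iff₀ ha, mul_comm]
      exact hle
    rw [Real.log_le_iff_le_exp (by positivity), div_mul_eq_mul_div, div_le_iff₀ hω] at h1
    linarith
  have hNE : (N : ℝ) = a * Real.log (E / ω) := by
    rw [hEdef, mul_div_cancel_left₀ _ hω.ne', Real.log_exp]
    field_simp
  have hlt := two_mul_lt_rpow ha hω hω1 (by linarith) hlarge.ge hE hNE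
  have hlogb : Real.logb 2 (2 * N) < E :=
    (Real.logb_lt_iff_lt_rpow (by norm_num) (by linarith)).2 hlt
  have hlogb0 : 1 ≤ Real.logb 2 (2 * N) := by
    simpa using succ_le_logb_two_mul (k := 0) (N := N) (by rwa [pow_zero])
  have hlog : Real.log (Real.logb 2 (2 * N) / ω) < N / a := by
    have : (N : ℝ) / a = Real.log (E / ω) := by
      rw [hNE]
      field_simp
    rw [this]
    exact Real.log_lt_log (by positivity) (by gcongr)
  have : confWidth N ω < Δ / 4 := by
    rw [confWidth, Real.sqrt_lt' (by positivity), div_lt_iff₀ (by positivity)]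
    rw [lt_div_iff₀ ha] at hlog
    have h2 : Δ ^ 2 * a = 64 := by
      rw [hadef]
      field_simp
    have h3 := mul_lt_mul_of_pos_left hlog (show 0 < Δ ^ 2 by positivity)
    rw [mul_comm _ a, ← mul_assoc, h2] at h3
    linarith
  linarith

/-! ### Deterministic analysis of the rounds -/

section Run

variable {lam : ℝ → ℝ} {n : ℕ} {δ β : ℝ} {x : ℕ → ℕ → ℝ} {z : ℕ → ℝ}

/-- On the reward table `x` the best arm is never beaten, and arm `i` is beaten by the best arm as
soon as both have been pulled `z i` times. -/
structure Separates (n : ℕ) (δ : ℝ) (x : ℕ → ℕ → ℝ) (z : ℕ → ℝ) : Prop where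
  not_beaten : ∀ i, 2 ≤ i → i ≤ n → ∀ N : ℕ, 0 < N →
    empMean (x i) N - empMean (x 1) N ≤ 2 * confWidth N (confParam n δ)
  beats : ∀ i, 2 ≤ i → i ≤ n → ∀ N : ℕ, 0 < N → z i ≤ N →
    2 * confWidth N (confParam n δ) < empMean (x 1) N - empMean (x i) N

/-- The alive arms, among them the best one, have all been pulled `N` times. -/
structure Balanced (n : ℕ) (s : State) (N : ℕ) : Prop where
  alive_subset : s.alive ⊆ Finset.Icc 1 n
  one_mem : 1 ∈ s.alive
  pulls_eq : ∀ i ∈ s.alive, s.pulls i = N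

theorem Balanced.card_pos {s : State} {N : ℕ} (h : Balanced n s N) : 0 < s.alive.card :=
  Finset.card_pos.2 ⟨1, h.one_mem⟩

theorem Balanced.card_le {s : State} {N : ℕ} (h : Balanced n s N) : s.alive.card ≤ n := by
  simpa using Finset.card_le_card h.alive_subset

theorem Balanced.one_le_div {s : State} {N : ℕ} (h : Balanced n s N) (hlam : IsScalingFunction lam)
    {t : ℝ} (ht : lam n ≤ t) : 1 ≤ invScaling lam t / s.alive.card := by
  have hm : (0 : ℝ) < s.alive.card := by exact_mod_cast h.card_pos
  have hmn : (s.alive.card : ℝ) ≤ n := by exact_mod_cast h.card_le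
  have hn : (0 : ℝ) ≤ n := n.cast_nonneg
  rw [one_le_div₀ hm]
  exact hmn.trans ((hlam.le_invScaling_iff hn ((hlam.nonneg hn).trans ht)).2 ht)

theorem Balanced.pullsPerArm_pos {s : State} {N : ℕ} (h : Balanced n s N)
    (hlam : IsScalingFunction lam) {t : ℝ} (ht : lam n ≤ t) :
    0 < pullsPerArm lam t s.alive.card :=
  Nat.floor_pos.2 (h.one_le_div hlam ht)

theorem Balanced.playRound (hsep : Separates n δ x z) {s : State} {N : ℕ} (h : Balanced n s N)
    (hlam : IsScalingFunction lam) {t : ℝ} (ht : lam n ≤ t) :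
    Balanced n (playRound lam n δ x t s) (N + pullsPerArm lam t s.alive.card) := by
  have hq := h.pullsPerArm_pos hlam ht
  have hpos : 0 < N + pullsPerArm lam t s.alive.card := by omega
  refine ⟨fun i hi => h.alive_subset (Finset.mem_filter.1 hi).1, ?_, fun i hi => ?_⟩
  · refine Finset.mem_filter.2 ⟨h.one_mem, ?_⟩
    rintro ⟨j, hj, hlt⟩
    simp only [ucb, lcb, if_pos hj, if_pos h.one_mem, h.pulls_eq j hj,
      h.pulls_eq 1 h.one_mem] at hlt
    obtain ⟨hj1, hjn⟩ := Finset.mem_Icc.1 (h.alive_subset hj)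
    rcases hj1.eq_or_lt with rfl | hj2
    · have : 0 ≤ confWidth (N + pullsPerArm lam t s.alive.card) (confParam n δ) :=
        Real.sqrt_nonneg _
      linarith
    · have := hsep.not_beaten j hj2 hjn _ hpos
      linarith
  · have hi' := (Finset.mem_filter.1 hi).1
    simp [APR.playRound, hi', h.pulls_eq i hi']

/-- Pulls from earlier rounds only help, so they are dropped and each round is judged on its own
pulls. -/
theorem Balanced.lt_of_mem_playRound (hsep : Separates n δ x z) {s : State} {N : ℕ}
    (h : Balanced n s N) (hlam : IsScalingFunction lam) {t : ℝ} (ht : lam n ≤ t) {i : ℕ}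
    (hi : i ∈ (APR.playRound lam n δ x t s).alive) (hi2 : 2 ≤ i) :
    (pullsPerArm lam t s.alive.card : ℝ) < z i := by
  have hq := h.pullsPerArm_pos hlam ht
  obtain ⟨hi', hnot⟩ := Finset.mem_filter.1 hi
  by_contra! hz
  have hz' : z i ≤ ((N + pullsPerArm lam t s.alive.card : ℕ) : ℝ) :=
    hz.trans (by exact_mod_cast Nat.le_add_left _ _)
  have := hsep.beats i hi2 (Finset.mem_Icc.1 (h.alive_subset hi')).2 _ (by omega) hz'
  refine hnot ⟨1, h.one_mem, ?_⟩
  simp only [ucb, lcb, if_pos hi', if_pos h.one_mem, h.pulls_eq i hi', h.pulls_eq 1 h.one_mem]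
  linarith

/-- A round of length at least `2 c 𝒯_2(z)` eliminates all but a fraction `1 / c` of the arms. -/
theorem Balanced.card_playRound_mul_le (hsep : Separates n δ x z) {s : State} {N : ℕ}
    (h : Balanced n s N) (hlam : IsScalingFunction lam)
    (hz : AntitoneOn (extendZero n z) (Set.Ici 2)) {t c : ℝ} (ht : lam n ≤ t) (hc : 1 ≤ c)
    (hct : 2 * c * elimTime lam n z 2 ≤ t) :
    (APR.playRound lam n δ x t s).alive.card ≤ 1 ∨
      ((APR.playRound lam n δ x t s).alive.card : ℝ) * c ≤ s.alive.card := by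
  have hm : (0 : ℝ) < s.alive.card := by exact_mod_cast h.card_pos
  have hc0 : 0 < c := by linarith
  have hn : 1 ≤ n := h.card_pos.trans_le h.card_le
  have hT := elimTime_nonneg hlam hz le_rfl
  obtain ⟨k, hk1, hkn, hor, hk⟩ := exists_mul_le_invScaling_elimTime hlam hz
    (θ := s.alive.card / c) le_rfl hn
  -- The factor `2` in the round length pays for the floor: `⌊u⌋ ≥ u / 2` once `u ≥ 1`, which holds
  -- because `t ≥ λ(n)`.
  have hq : extendZero n z (k + 1) ≤ pullsPerArm lam t s.alive.card := by
    have h1 := h.one_le_div hlam ht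
    have h2 := Nat.lt_floor_add_one (invScaling lam t / s.alive.card)
    have h3 : (1 : ℝ) ≤ pullsPerArm lam t s.alive.card := by
      exact_mod_cast h.pullsPerArm_pos hlam ht
    have h4 := hlam.mul_invScaling_le (c := 2 * c) (by linarith) hT
    have h5 := hlam.invScaling_mono (by positivity) hct
    rw [div_mul_eq_mul_div, div_le_iff₀ hc0] at hk
    have h6 : extendZero n z (k + 1) ≤ invScaling lam t / s.alive.card / 2 := by
      rw [div_div, le_div_iff₀ (by positivity)]
      linarith
    have h7 : invScaling lam t / s.alive.card < pullsPerArm lam t s.alive.card + 1 := h2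
    linarith
  have hsubset : (APR.playRound lam n δ x t s).alive ⊆ Finset.Icc 1 k := by
    intro i hi
    have hi1 := Finset.mem_Icc.1 ((h.playRound hsep hlam ht).alive_subset hi)
    refine Finset.mem_Icc.2 ⟨hi1.1, ?_⟩
    by_contra! hki
    have h1 := h.lt_of_mem_playRound hsep hlam ht hi (by omega)
    have h2 := hz (Set.mem_Ici.2 (by omega : 2 ≤ k + 1)) (Set.mem_Ici.2 (by omega : 2 ≤ i)) hki
    rw [extendZero_of_le hi1.2] at h2
    linarith
  have hcard := Finset.card_le_card hsubset
  rw [Nat.card_Icc, Nat.add_sub_cancel] at hcard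
  rcases hor with rfl | hlt
  · exact Or.inl hcard
  · right
    have : ((APR.playRound lam n δ x t s).alive.card : ℝ) ≤ k := by exact_mod_cast hcard
    exact (le_div_iff₀ hc0).1 (this.trans hlt.le)

theorem time_playRound_le (hlam : IsScalingFunction lam) {s : State} {t : ℝ} (ht : 0 ≤ t)
    (hs : 0 < s.alive.card) : (playRound lam n δ x t s).time ≤ s.time + t := by
  have hm : (0 : ℝ) < s.alive.card := by exact_mod_cast hs
  refine add_le_add le_rfl ?_
  have hinv := hlam.invScaling_nonneg ht
  rw [← hlam.le_invScaling_iff (by positivity) ht, mul_comm, ← le_div_iff₀ hm]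
  exact Nat.floor_le (by positivity)

theorem le_pow_mul (hlam : IsScalingFunction lam) (hβ : 1 < β) (r : ℕ) :
    lam n ≤ β ^ r * lam n :=
  le_mul_of_one_le_left (hlam.nonneg n.cast_nonneg) (one_le_pow₀ hβ.le)

theorem exists_balanced_run (hsep : Separates n δ x z) (hlam : IsScalingFunction lam)
    (hβ : 1 < β) (hn : 1 ≤ n) (r : ℕ) : ∃ N, Balanced n (run lam β n δ x r) N := by
  induction r with
  | zero => exact ⟨0, subset_rfl, Finset.mem_Icc.2 ⟨le_rfl, hn⟩, fun _ _ => rfl⟩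
  | succ r ih =>
    obtain ⟨N, hN⟩ := ih
    rw [run]
    split_ifs
    · exact ⟨_, hN.playRound hsep hlam (le_pow_mul hlam hβ r)⟩
    · exact ⟨N, hN⟩

/-- Each round costs at most its allocation; the bound is the geometric sum with its term `-1`
dropped, which makes the induction exact. -/
theorem time_run_le (hsep : Separates n δ x z) (hlam : IsScalingFunction lam)
    (hβ : 1 < β) (hn : 1 ≤ n) (r : ℕ) :
    (run lam β n δ x r).time ≤ β ^ r * lam n / (β - 1) := by
  have hβ' : 0 < β - 1 := sub_pos.2 hβ
  have hl := hlam.nonneg (Nat.cast_nonneg n : (0 : ℝ) ≤ n)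
  induction r with
  | zero => exact div_nonneg (by simpa using hl) hβ'.le
  | succ r ih =>
    obtain ⟨N, hN⟩ := exists_balanced_run hsep hlam hβ hn r
    have ht : 0 ≤ β ^ r * lam n := hl.trans (le_pow_mul hlam hβ r)
    have hsum : β ^ r * lam n / (β - 1) + β ^ r * lam n = β ^ (r + 1) * lam n / (β - 1) := by
      field_simp
      ring
    rw [← hsum, run]
    split_ifs
    · exact (time_playRound_le hlam ht hN.card_pos).trans (by linarith)
    · linarith

/-- The `b`-th round after `r`, counted from `0`, is long enough for reduction factor `β ^ b`, and
the factors multiply. -/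
theorem card_run_mul_pow_le (hsep : Separates n δ x z) (hlam : IsScalingFunction lam)
    (hz : AntitoneOn (extendZero n z) (Set.Ici 2)) (hβ : 1 < β) (hn : 1 ≤ n) {r : ℕ}
    (hr : 2 * elimTime lam n z 2 ≤ β ^ r * lam n) (a : ℕ) :
    (run lam β n δ x (r + a)).alive.card ≤ 1 ∨
      ((run lam β n δ x (r + a)).alive.card : ℝ) * β ^ (∑ b ∈ Finset.range a, b) ≤ n := by
  induction a with
  | zero =>
    obtain ⟨N, hN⟩ := exists_balanced_run hsep hlam hβ hn r
    right
    simpa using hN.card_le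
  | succ a ih =>
    obtain ⟨N, hN⟩ := exists_balanced_run hsep hlam hβ hn (r + a)
    rw [← add_assoc, run]
    split_ifs with hcard
    · have hβa : 1 ≤ β ^ a := one_le_pow₀ hβ.le
      have hct : 2 * β ^ a * elimTime lam n z 2 ≤ β ^ (r + a) * lam n := by
        rw [pow_add]
        nlinarith
      refine (hN.card_playRound_mul_le hsep hlam hz (le_pow_mul hlam hβ _) hβa hct).imp id
        fun h => ?_
      rw [Finset.sum_range_succ, pow_add β (∑ b ∈ Finset.range a, b), mul_comm (β ^ _) (β ^ a),
        ← mul_assoc]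
      exact (mul_le_mul_of_nonneg_right h (by positivity)).trans (ih.resolve_left hcard.not_ge)
    · exact Or.inl (not_lt.1 hcard)

/-- With `θ = n` the reachable level cannot be `z_{n+1} = 0`, so it is at least `1`. This controls
the case in which already the first allocation reaches `2T`. -/
theorem le_elimTime (hlam : IsScalingFunction lam)
    (hz : AntitoneOn (extendZero n z) (Set.Ici 2)) (hz1 : ∀ i, 2 ≤ i → i ≤ n → 1 ≤ z i)
    (hn : 2 ≤ n) : lam n ≤ elimTime lam n z 2 := by
  obtain ⟨k, hk1, hkn, hor, hk⟩ := exists_mul_le_invScaling_elimTime hlam hz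
    (θ := (n : ℝ)) le_rfl (by omega : 1 ≤ n)
  have hk' : k + 1 ≤ n := by
    rcases hor with rfl | h
    · exact hn
    · exact_mod_cast h
  rw [← hlam.le_invScaling_iff n.cast_nonneg (elimTime_nonneg hlam hz le_rfl)]
  refine le_trans ?_ hk
  rw [extendZero_of_le hk']
  exact le_mul_of_one_le_right n.cast_nonneg (hz1 _ (by omega) hk')

theorem exists_returns (hsep : Separates n δ x z) (hlam : IsScalingFunction lam)
    (hz : AntitoneOn (extendZero n z) (Set.Ici 2)) (hz1 : ∀ i, 2 ≤ i → i ≤ n → 1 ≤ z i)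
    (hβ : 1 < β) (hn : 2 ≤ n) :
    ∃ T, Returns lam β n δ x 1 T ∧
      T ≤ 4 * (β ^ (3 + 4 * √(Real.logb β n)) / (β - 1)) * elimTime lam n z 2 := by
  have hβ0 : 0 < β := by linarith
  have hβ' : 0 < β - 1 := sub_pos.2 hβ
  have hn0 : (0 : ℝ) < n := by positivity
  have hn1 : (1 : ℝ) ≤ n := by exact_mod_cast (by omega : 1 ≤ n)
  have hl : 0 < lam n := by
    rw [← hlam.map_zero]
    exact hlam.strictMonoOn (Set.mem_Ici.2 le_rfl) hn0.le hn0
  have hlT := le_elimTime hlam hz hz1 hn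
  set T := elimTime lam n z 2
  have hT : 0 < T := hl.trans_le hlT
  have hex : ∃ r : ℕ, 2 * T ≤ β ^ r * lam n := by
    obtain ⟨r, hr⟩ := pow_unbounded_of_one_lt (2 * T / lam n) hβ
    exact ⟨r, ((div_lt_iff₀ hl).1 hr).le⟩
  classical
  obtain ⟨r, hr, hmin⟩ : ∃ r : ℕ, 2 * T ≤ β ^ r * lam n ∧ β ^ r * lam n ≤ β * (2 * T) := by
    refine ⟨Nat.find hex, Nat.find_spec hex, ?_⟩
    rcases hr : Nat.find hex with _ | r
    · have := Nat.find_spec hex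
      rw [hr] at this
      linarith
    · have := Nat.find_min hex (m := r) (by omega)
      rw [pow_succ, mul_comm _ β, mul_assoc]
      exact mul_le_mul_of_nonneg_left (not_le.1 this).le hβ0.le
  set l := Real.logb β n with hldef
  have hl0 : 0 ≤ l := Real.logb_nonneg hβ hn1
  -- Then `0 + 1 + ⋯ + A = A (A + 1) / 2 ≥ log_β n`, so `A + 1` rounds leave one arm.
  set A := ⌈√(2 * l)⌉₊
  have hA : √(2 * l) ≤ A := Nat.le_ceil _
  have hA' : (A : ℝ) < √(2 * l) + 1 := Nat.ceil_lt_add_one (Real.sqrt_nonneg _)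
  have hpow : (n : ℝ) ≤ β ^ (∑ b ∈ Finset.range (A + 1), b) := by
    have h1 : ((∑ b ∈ Finset.range (A + 1), b : ℕ) : ℝ) * 2 = (A + 1) * A := by
      exact_mod_cast Finset.sum_range_id_mul_two (A + 1)
    have h2 : 2 * l ≤ A ^ 2 := (Real.sqrt_le_left A.cast_nonneg).1 hA
    calc (n : ℝ) = β ^ l := (Real.rpow_logb hβ0 hβ.ne' hn0).symm
      _ ≤ β ^ ((∑ b ∈ Finset.range (A + 1), b : ℕ) : ℝ) :=
        Real.rpow_le_rpow_of_exponent_le hβ.le (by nlinarith [A.cast_nonneg (α := ℝ)])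
      _ = _ := Real.rpow_natCast _ _
  obtain ⟨N, hN⟩ := exists_balanced_run hsep hlam hβ (by omega) (r + (A + 1))
  have hcard : (run lam β n δ x (r + (A + 1))).alive.card ≤ 1 := by
    refine (card_run_mul_pow_le hsep hlam hz hβ (by omega) hr (A + 1)).elim id fun h => ?_
    have := le_of_mul_le_mul_right (h.trans (hpow.trans_eq (one_mul _).symm))
      (pow_pos hβ0 _)
    exact_mod_cast this
  refine ⟨_, ⟨r + (A + 1), ?_, rfl⟩, (time_run_le hsep hlam hβ (by omega) _).trans ?_⟩
  · exact (Finset.eq_singleton_iff_unique_mem).2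
      ⟨hN.one_mem, fun i hi => Finset.card_le_one.1 hcard i hi 1 hN.one_mem⟩
  -- The target is loose here: `√2` in place of `4` would do, and below a factor `2` is also given
  -- away.
  · have hsqrt : √(2 * l) ≤ 4 * √l := by
      rw [Real.sqrt_le_left (by positivity), mul_pow, Real.sq_sqrt hl0]
      linarith
    have hexp : β ^ (A + 2) ≤ β ^ (3 + 4 * √l) := by
      rw [← Real.rpow_natCast]
      refine Real.rpow_le_rpow_of_exponent_le hβ.le ?_
      push_cast
      linarith
    have h1 : β ^ (r + (A + 1)) * lam n ≤ 2 * (β ^ (A + 2) * T) := by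
      have := mul_le_mul_of_nonneg_left hmin (pow_nonneg hβ0.le (A + 1))
      calc β ^ (r + (A + 1)) * lam n = β ^ (A + 1) * (β ^ r * lam n) := by ring
        _ ≤ _ := this
        _ = _ := by ring
    have h2 : β ^ (A + 2) * T ≤ β ^ (3 + 4 * √l) * T := mul_le_mul_of_nonneg_right hexp hT.le
    have h3 : 0 ≤ β ^ (A + 2) * T := by positivity
    rw [div_le_iff₀ hβ']
    calc β ^ (r + (A + 1)) * lam n ≤ 4 * (β ^ (3 + 4 * √l) * T) := by linarith
      _ = _ := by field_simp

end Run

/-! ### The confidence parameter, the gaps and the pull bounds -/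

theorem confParam_pos {n : ℕ} {δ : ℝ} (hn : 1 ≤ n) (hδ : 0 < δ) : 0 < confParam n δ := by
  have : (0 : ℝ) < n := by exact_mod_cast hn
  exact Real.sqrt_pos.2 (by positivity)

theorem confParam_sq {n : ℕ} {δ : ℝ} (hδ : 0 < δ) : confParam n δ ^ 2 = δ / (6 * n) :=
  Real.sq_sqrt (by positivity)

theorem confParam_le_one {n : ℕ} {δ : ℝ} (hn : 1 ≤ n) (hδ1 : δ < 1) : confParam n δ ≤ 1 := by
  have : (1 : ℝ) ≤ n := by exact_mod_cast hn
  rw [confParam, Real.sqrt_le_one, div_le_one (by positivity)]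
  linarith

theorem logFactor_anti {ω Δ Δ' : ℝ} (hω : 0 < ω) (hω1 : ω ≤ 1) (hΔ : 0 < Δ) (h : Δ ≤ Δ')
    (hΔ1 : Δ' ≤ 1) : logFactor ω Δ' ≤ logFactor ω Δ := by
  have hΔ' : 0 < Δ' := hΔ.trans_le h
  have h7 := seven_le_logb hω hω1 hΔ' hΔ1
  refine Real.log_le_log (by positivity) (mul_le_mul_of_nonneg_left ?_ (by positivity))
  exact Real.logb_le_logb_of_le (by norm_num) (by positivity) (by gcongr)

theorem logFactor_nonneg {ω Δ : ℝ} (hω : 0 < ω) (hω1 : ω ≤ 1) (hΔ : 0 < Δ) (hΔ1 : Δ ≤ 1) :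
    0 ≤ logFactor ω Δ := by
  have h7 := seven_le_logb hω hω1 hΔ hΔ1
  have h2 : 1 ≤ 2 / ω := (one_le_div hω).2 (by linarith)
  exact Real.log_nonneg (by nlinarith)

section Gaps

variable {n : ℕ} {δ : ℝ} {ν : ℕ → Measure ℝ}

/-- The gaps are positive, at most one and increasing. -/
structure OrderedGaps (n : ℕ) (ν : ℕ → Measure ℝ) : Prop where
  pos : ∀ i, 2 ≤ i → i ≤ n → 0 < gap ν i
  le_one : ∀ i, 2 ≤ i → i ≤ n → gap ν i ≤ 1
  mono : MonotoneOn (gap ν) (Set.Icc 2 n)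

theorem gap_of_two_le {i : ℕ} (hi : 2 ≤ i) : gap ν i = mean (ν 1) - mean (ν i) :=
  if_neg (by omega)

theorem orderedGaps (hmean : ∀ i ∈ Finset.Icc 1 n, mean (ν i) ∈ Set.Icc (0 : ℝ) 1)
    (hbest : mean (ν 2) < mean (ν 1)) (hsorted : AntitoneOn (fun i => mean (ν i)) (Set.Icc 1 n)) :
    OrderedGaps n ν where
  pos i hi hin := by
    have : mean (ν i) ≤ mean (ν 2) :=
      hsorted ⟨one_le_two, hi.trans hin⟩ ⟨by omega, hin⟩ hi
    rw [gap_of_two_le hi]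
    linarith
  le_one i hi hin := by
    rw [gap_of_two_le hi]
    linarith [(hmean 1 (Finset.mem_Icc.2 ⟨le_rfl, by omega⟩)).2,
      (hmean i (Finset.mem_Icc.2 ⟨by omega, hin⟩)).1]
  mono i hi k hk hik := by
    have : mean (ν k) ≤ mean (ν i) :=
      hsorted ⟨by linarith [hi.1], hi.2⟩ ⟨by linarith [hk.1], hk.2⟩ hik
    rw [gap_of_two_le hi.1, gap_of_two_le hk.1]
    linarith

namespace OrderedGaps

theorem inv_sq_anti (h : OrderedGaps n ν) :
    AntitoneOn (fun i => (gap ν i ^ 2)⁻¹) (Set.Icc 2 n) := by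
  intro i hi k hk hik
  have h1 := h.pos i hi.1 hi.2
  have h2 := h.mono hi hk hik
  simp only
  gcongr

theorem one_le_inv_sq (h : OrderedGaps n ν) {i : ℕ} (hi : 2 ≤ i) (hin : i ≤ n) :
    1 ≤ (gap ν i ^ 2)⁻¹ :=
  (one_le_inv₀ (pow_pos (h.pos i hi hin) 2)).2 (pow_le_one₀ (h.pos i hi hin).le (h.le_one i hi hin))

theorem pulls_nonneg (h : OrderedGaps n ν) {ω : ℝ} (hω : 0 < ω) (hω1 : ω ≤ 1) {i : ℕ}
    (hi : 2 ≤ i) (hin : i ≤ n) : 0 ≤ 64 * (gap ν i ^ 2)⁻¹ * logFactor ω (gap ν i) := by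
  have h1 := h.one_le_inv_sq hi hin
  have h2 := logFactor_nonneg hω hω1 (h.pos i hi hin) (h.le_one i hi hin)
  positivity

theorem one_le_pullBound (h : OrderedGaps n ν) (hδ : 0 < δ) (hδ1 : δ < 1) {i : ℕ}
    (hi : 2 ≤ i) (hin : i ≤ n) : 1 ≤ pullBound n δ ν i := by
  have h0 := h.pulls_nonneg (confParam_pos (by omega : 1 ≤ n) hδ)
    (confParam_le_one (by omega) hδ1) hi hin
  have : (0 : ℝ) ≤ ⌊64 * (gap ν i ^ 2)⁻¹ * logFactor (confParam n δ) (gap ν i)⌋ := by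
    exact_mod_cast Int.floor_nonneg.2 h0
  rw [pullBound]
  linarith

theorem pulls_le_pulls (h : OrderedGaps n ν) {ω : ℝ} (hω : 0 < ω) (hω1 : ω ≤ 1) {i k : ℕ}
    (hi : 2 ≤ i) (hik : i ≤ k) (hkn : k ≤ n) :
    64 * (gap ν k ^ 2)⁻¹ * logFactor ω (gap ν k) ≤
      64 * (gap ν i ^ 2)⁻¹ * logFactor ω (gap ν i) := by
  have hi' : i ∈ Set.Icc 2 n := ⟨hi, hik.trans hkn⟩
  have hk' : k ∈ Set.Icc 2 n := ⟨hi.trans hik, hkn⟩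
  have h1 := h.inv_sq_anti hi' hk' hik
  have h2 := logFactor_anti hω hω1 (h.pos i hi hi'.2) (h.mono hi' hk' hik)
    (h.le_one k hk'.1 hkn)
  have h3 := logFactor_nonneg hω hω1 (h.pos k hk'.1 hkn) (h.le_one k hk'.1 hkn)
  have h4 := h.one_le_inv_sq hi hi'.2
  exact mul_le_mul (mul_le_mul_of_nonneg_left h1 (by norm_num)) h2 h3 (by linarith)

theorem antitoneOn_pullBound (h : OrderedGaps n ν) (hδ : 0 < δ) (hδ1 : δ < 1) :
    AntitoneOn (extendZero n (pullBound n δ ν)) (Set.Ici 2) := by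
  refine antitoneOn_extendZero (fun i hi k hk hik => ?_) fun i hi =>
    zero_le_one.trans (h.one_le_pullBound hδ hδ1 hi.1 hi.2)
  have hn : 1 ≤ n := by linarith [hi.1, hi.2]
  have := Int.floor_le_floor (h.pulls_le_pulls (confParam_pos hn hδ) (confParam_le_one hn hδ1)
    hi.1 hik hk.2)
  simp only [pullBound]
  gcongr

theorem antitoneOn_inv_sq (h : OrderedGaps n ν) :
    AntitoneOn (extendZero n fun i => (gap ν i ^ 2)⁻¹) (Set.Ici 2) :=
  antitoneOn_extendZero h.inv_sq_anti fun _ _ => by positivity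

theorem pullBound_le (h : OrderedGaps n ν) (hδ : 0 < δ) (hδ1 : δ < 1) {i : ℕ}
    (hi : 2 ≤ i) (hin : i ≤ n) :
    pullBound n δ ν i ≤
      128 * max (logFactor (confParam n δ) (gap ν 2)) (1 / 64) * (gap ν i ^ 2)⁻¹ := by
  have hn : 1 ≤ n := by omega
  have h2 : 2 ∈ Set.Icc 2 n := ⟨le_rfl, hi.trans hin⟩
  have h1 := h.one_le_inv_sq hi hin
  have hlog := logFactor_anti (confParam_pos hn hδ) (confParam_le_one hn hδ1) (h.pos 2 le_rfl h2.2)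
    (h.mono h2 ⟨hi, hin⟩ hi) (h.le_one i hi hin)
  have hmax := hlog.trans (le_max_left _ (1 / 64))
  have hmax' := le_max_right (logFactor (confParam n δ) (gap ν 2)) (1 / 64)
  have hfloor := Int.floor_le (64 * (gap ν i ^ 2)⁻¹ * logFactor (confParam n δ) (gap ν i))
  rw [pullBound]
  set M := max (logFactor (confParam n δ) (gap ν 2)) (1 / 64)
  -- The constant `128` is `64 + 64`: one half bounds the floor, and the other absorbs the summand
  -- `1`, as `M ≥ 1 / 64` and `Δ_i ≤ 1`.
  have h3 := mul_le_mul_of_nonneg_left hmax (by linarith : 0 ≤ 64 * (gap ν i ^ 2)⁻¹)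
  have h4 := mul_le_mul_of_nonneg_right hmax' (by linarith : 0 ≤ 64 * (gap ν i ^ 2)⁻¹)
  linarith

theorem elimTime_pullBound_le (h : OrderedGaps n ν) {lam : ℝ → ℝ} (hlam : IsScalingFunction lam)
    (hδ : 0 < δ) (hδ1 : δ < 1) :
    elimTime lam n (pullBound n δ ν) 2 ≤
      128 * max (logFactor (confParam n δ) (gap ν 2)) (1 / 64) * Tstar lam n ν := by
  set c := 128 * max (logFactor (confParam n δ) (gap ν 2)) (1 / 64) with hc
  have hc1 : 1 ≤ c := by
    have := le_max_right (logFactor (confParam n δ) (gap ν 2)) (1 / 64)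
    linarith
  have hanti : AntitoneOn (extendZero n fun i => c * (gap ν i ^ 2)⁻¹) (Set.Ici 2) := by
    intro i hi k hk hik
    simp only [extendZero_const_mul]
    exact mul_le_mul_of_nonneg_left (h.antitoneOn_inv_sq hi hk hik) (by linarith)
  refine (elimTime_mono hlam (h.antitoneOn_pullBound hδ hδ1) hanti (fun i hi => ?_) le_rfl).trans
    (elimTime_const_mul_le hlam h.antitoneOn_inv_sq hc1 le_rfl)
  rcases le_or_gt i n with hin | hin
  · rw [extendZero_of_le hin, extendZero_of_le hin]
    exact h.pullBound_le hδ hδ1 hi hin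
  · rw [extendZero_of_lt hin, extendZero_of_lt hin]

theorem separates (h : OrderedGaps n ν) (hδ : 0 < δ) (hδ1 : δ < 1) {x : ℕ → ℕ → ℝ}
    (hx : ∀ i, 2 ≤ i → i ≤ n → ∀ N : ℕ, 0 < N →
      |empMean (x i) N - empMean (x 1) N + gap ν i| ≤ 2 * confWidth N (confParam n δ)) :
    Separates n δ x (pullBound n δ ν) where
  not_beaten i hi hin N hN := by
    have := (abs_le.1 (hx i hi hin N hN)).2
    linarith [h.pos i hi hin]
  beats i hi hin N hN hz := by
    have hn : 1 ≤ n := by omega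
    have h1 := (abs_le.1 (hx i hi hin N hN)).2
    have h2 : 64 * (gap ν i ^ 2)⁻¹ * logFactor (confParam n δ) (gap ν i) ≤ N := by
      rw [pullBound] at hz
      linarith [Int.lt_floor_add_one
        (64 * (gap ν i ^ 2)⁻¹ * logFactor (confParam n δ) (gap ν i))]
    have h3 := four_mul_confWidth_lt (confParam_pos hn hδ) (confParam_le_one hn hδ1)
      (h.pos i hi hin) (h.le_one i hi hin) hN h2
    linarith

end OrderedGaps

end Gaps

/-! ### Probability of the good event -/

section GoodEvent

variable {Ω : Type*} [MeasurableSpace Ω] {P : Measure Ω}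

theorem sum_sub_sub_sub (x y : ℕ → ℝ) (a b : ℝ) {N : ℕ} (hN : 0 < N) :
    ∑ l ∈ Finset.range N, ((x l - a) - (y l - b)) =
      N * (empMean x N - empMean y N + (b - a)) := by
  have : (N : ℝ) ≠ 0 := by exact_mod_cast hN.ne'
  simp only [empMean, Finset.sum_sub_distrib, Finset.sum_const, Finset.card_range, nsmul_eq_mul]
  field_simp
  ring

variable [IsProbabilityMeasure P]

/-- Time-uniform deviation bound for the difference of the empirical means of two arms. -/
theorem measure_exists_confWidth_lt_empMean_le {ι : Type*} {X : ι × ℕ → Ω → ℝ}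
    {ν : ι → Measure ℝ} (hsub : ∀ i, HasSubgaussianMGF (fun y => y - mean (ν i)) 1 (ν i))
    (hlaw : ∀ p, HasLaw (X p) (ν p.1) P) (hind : iIndepFun X P) {i j : ι} (hij : i ≠ j)
    {ω : ℝ} (hω : 0 < ω) (hω1 : ω ≤ 1) :
    P {w | ∃ N : ℕ, 0 < N ∧ 2 * confWidth N ω <
        empMean (fun l => X (i, l) w) N - empMean (fun l => X (j, l) w) N +
          (mean (ν j) - mean (ν i))} ≤ ENNReal.ofReal (2 * ω ^ 2) := by
  -- `HasLaw` gives only a.e. measurability, whereas the filtration needs measurable variables.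
  let X' : ι × ℕ → Ω → ℝ := fun p => (hlaw p).aemeasurable.mk
  have hX' : ∀ p, Measurable (X' p) := fun p => (hlaw p).aemeasurable.measurable_mk
  have hae : ∀ p, X p =ᵐ[P] X' p := fun p => (hlaw p).aemeasurable.ae_eq_mk
  let Z : ι × ℕ → Ω → ℝ := fun p w => X' p w - mean (ν p.1)
  have hZ : ∀ p, Measurable (Z p) := fun p => (hX' p).sub_const _
  have hZind : iIndepFun Z P :=
    ((iIndepFun_congr hae).1 hind).comp (fun p y => y - mean (ν p.1))
      fun p => measurable_id.sub_const _
  have hlaw' : ∀ p, HasLaw (X' p) (ν p.1) P := fun p => (hlaw p).congr (hae p).symm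
  have hZsub : ∀ p, HasSubgaussianMGF (Z p) 1 P := fun p => by
    have h := hsub p.1
    rw [← (hlaw' p).map_eq] at h
    have := HasSubgaussianMGF.of_map (hX' p).aemeasurable h
    rwa [(hlaw' p).map_eq] at this
  have hZmean : ∀ p, ∫ w, Z p w ∂P = 0 := fun p => by
    have hint : Integrable (X' p) P := by
      refine ((hZsub p).integrable.add (integrable_const (mean (ν p.1)))).congr
        (ae_of_all _ fun w => ?_)
      simp [Z]
    have : ∫ w, X' p w ∂P = mean (ν p.1) := (hlaw' p).integral_eq
    simp only [Z]
    rw [integral_sub hint (integrable_const _), this]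
    simp
  refine le_trans (measure_mono_ae ?_)
    (measure_exists_confWidth_lt_le Z hZ hZind hZsub hZmean hij hω hω1)
  filter_upwards [ae_all_iff.2 fun l => hae (i, l), ae_all_iff.2 fun l => hae (j, l)] with w h1 h2
  rintro ⟨N, hN, hlt⟩
  refine ⟨N, hN, ?_⟩
  have hN' : (0 : ℝ) < N := by exact_mod_cast hN
  have := mul_lt_mul_of_pos_left hlt hN'
  rw [← sum_sub_sub_sub _ _ _ _ hN] at this
  simp only [h1, h2] at this
  simp only [Z]
  linarith

/-- With probability at least `1 - δ`, all empirical gaps are close to the gaps at all times. -/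
theorem one_sub_le_measureReal_forall_abs_le {n : ℕ} {δ : ℝ} (hn : 1 ≤ n) (hδ : 0 < δ)
    (hδ1 : δ < 1) {ν : ℕ → Measure ℝ}
    (hsub : ∀ i ∈ Finset.Icc 1 n, HasSubgaussianMGF (fun y => y - mean (ν i)) 1 (ν i))
    {X : ℕ → ℕ → Ω → ℝ} (hlaw : ∀ i ∈ Finset.Icc 1 n, ∀ k : ℕ, HasLaw (X i k) (ν i) P)
    (hindep : iIndepFun (fun p : Finset.Icc 1 n × ℕ => X p.1 p.2) P) :
    1 - δ ≤ P.real {w | ∀ i, 2 ≤ i → i ≤ n → ∀ N : ℕ, 0 < N →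
      |empMean (fun k => X i k w) N - empMean (fun k => X 1 k w) N + gap ν i| ≤
        2 * confWidth N (confParam n δ)} := by
  set G := {w | ∀ i, 2 ≤ i → i ≤ n → ∀ N : ℕ, 0 < N →
      |empMean (fun k => X i k w) N - empMean (fun k => X 1 k w) N + gap ν i| ≤
        2 * confWidth N (confParam n δ)}
  have hω := confParam_pos hn hδ
  have hω1 := confParam_le_one hn hδ1
  let B : ℕ → ℕ → Set Ω := fun i j => {w | ∃ N : ℕ, 0 < N ∧ 2 * confWidth N (confParam n δ) <
    empMean (fun k => X i k w) N - empMean (fun k => X j k w) N + (mean (ν j) - mean (ν i))}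
  have hB : ∀ i ∈ Finset.Icc 1 n, ∀ j ∈ Finset.Icc 1 n, i ≠ j →
      P (B i j) ≤ ENNReal.ofReal (2 * confParam n δ ^ 2) := fun i hi j hj hij =>
    measure_exists_confWidth_lt_empMean_le (ι := Finset.Icc 1 n)
      (X := fun p : Finset.Icc 1 n × ℕ => X p.1 p.2) (ν := fun i => ν i)
      (fun i => hsub i i.2) (fun p => hlaw p.1 p.1.2 p.2) hindep (i := ⟨i, hi⟩) (j := ⟨j, hj⟩)
      (by simpa using hij) hω hω1
  have hcompl : Gᶜ ⊆ ⋃ i ∈ Finset.Icc 2 n, (B i 1 ∪ B 1 i) := by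
    intro w hw
    simp only [G, Set.mem_compl_iff, Set.mem_ofPred_eq, not_forall, not_le] at hw
    obtain ⟨i, hi, hin, N, hN, hlt⟩ := hw
    refine Set.mem_iUnion₂.2 ⟨i, Finset.mem_Icc.2 ⟨hi, hin⟩, ?_⟩
    rw [gap_of_two_le hi] at hlt
    rcases lt_abs.1 hlt with h | h
    · exact Or.inl ⟨N, hN, h⟩
    · exact Or.inr ⟨N, hN, by linarith⟩
  have hone : 1 ∈ Finset.Icc 1 n := Finset.mem_Icc.2 ⟨le_rfl, hn⟩
  have hbound : P Gᶜ ≤ ENNReal.ofReal δ := by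
    calc P Gᶜ ≤ ∑ i ∈ Finset.Icc 2 n, P (B i 1 ∪ B 1 i) :=
          (measure_mono hcompl).trans (measure_biUnion_finset_le _ _)
      _ ≤ ∑ _i ∈ Finset.Icc 2 n, ENNReal.ofReal (4 * confParam n δ ^ 2) := by
          refine Finset.sum_le_sum fun i hi => ?_
          obtain ⟨hi2, hin⟩ := Finset.mem_Icc.1 hi
          have hi' : i ∈ Finset.Icc 1 n := Finset.mem_Icc.2 ⟨by omega, hin⟩
          refine (measure_union_le _ _).trans ((add_le_add (hB i hi' 1 hone (by omega))
            (hB 1 hone i hi' (by omega))).trans_eq ?_)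
          rw [← ENNReal.ofReal_add (by positivity) (by positivity)]
          ring_nf
      _ = ENNReal.ofReal ((n - 1 : ℕ) * (4 * confParam n δ ^ 2)) := by
          rw [Finset.sum_const, Nat.card_Icc, nsmul_eq_mul,
            ENNReal.ofReal_mul (Nat.cast_nonneg (n - 1)), ENNReal.ofReal_natCast]
          rfl
      _ ≤ ENNReal.ofReal δ := by
          refine ENNReal.ofReal_le_ofReal ?_
          have hn0 : (0 : ℝ) < n := by exact_mod_cast hn
          have h1 : ((n - 1 : ℕ) : ℝ) ≤ n := by exact_mod_cast Nat.sub_le n 1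
          -- Each of the `n - 1` suboptimal arms has two one-sided failures of probability at most
          -- `2ω²`; with `ω² = δ / (6n)` the total is at most `2δ / 3`.
          have h2 : (n : ℝ) * (4 * confParam n δ ^ 2) = 2 / 3 * δ := by
            rw [confParam_sq hδ]
            field_simp
            ring
          have h3 := mul_le_mul_of_nonneg_right h1 (by positivity : 0 ≤ 4 * confParam n δ ^ 2)
          linarith
  have hreal : P.real Gᶜ ≤ δ := ENNReal.toReal_le_of_le_ofReal hδ.le hbound
  -- Subadditivity suffices, so measurability of `G` is not needed.
  have huniv : (1 : ℝ) ≤ P.real G + P.real Gᶜ := by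
    have := measureReal_union_le (μ := P) G Gᶜ
    rwa [Set.union_compl_self, probReal_univ] at this
  linarith

end GoodEvent

end APR

theorem theorem1 {Ω : Type*} [MeasurableSpace Ω] (P : Measure Ω) [IsProbabilityMeasure P]
    (lam : ℝ → ℝ) (hlam : APR.IsScalingFunction lam)
    (n : ℕ) (β δ : ℝ) (hβ : 1 < β) (hβn : β ≤ n) (hδ : 0 < δ) (hδ1 : δ < 1)
    -- the reward distributions of the arms `1, …, n`
    (ν : ℕ → Measure ℝ)
    (hsub : ∀ i ∈ Finset.Icc 1 n, HasSubgaussianMGF (fun y => y - APR.mean (ν i)) 1 (ν i))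
    (hmean : ∀ i ∈ Finset.Icc 1 n, APR.mean (ν i) ∈ Set.Icc (0 : ℝ) 1)
    (hbest : APR.mean (ν 2) < APR.mean (ν 1))
    (hsorted : AntitoneOn (fun i => APR.mean (ν i)) (Set.Icc 1 n))
    -- `X i k` is the reward of the `(k + 1)`-st pull of arm `i`
    (X : ℕ → ℕ → Ω → ℝ)
    (hlaw : ∀ i ∈ Finset.Icc 1 n, ∀ k : ℕ, HasLaw (X i k) (ν i) P)
    (hindep : iIndepFun (fun p : Finset.Icc 1 n × ℕ => X p.1 p.2) P) :
    1 - δ ≤ P.real {w | ∃ T : ℝ, APR.Returns lam β n δ (fun i k => X i k w) 1 T ∧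
        T ≤ 4 * (β ^ (3 + 4 * √(Real.logb β n)) / (β - 1)) *
          APR.elimTime lam n (APR.pullBound n δ ν) 2} ∧
    4 * (β ^ (3 + 4 * √(Real.logb β n)) / (β - 1)) *
          APR.elimTime lam n (APR.pullBound n δ ν) 2 ≤
      512 * (β ^ (3 + 4 * √(Real.logb β n)) / (β - 1)) *
        max (APR.logFactor (APR.confParam n δ) (APR.gap ν 2)) (1 / 64) *
        APR.Tstar lam n ν := by
  have hn : 2 ≤ n := by
    have : (1 : ℝ) < n := hβ.trans_le hβn
    exact_mod_cast this
  have hgaps := APR.orderedGaps hmean hbest hsorted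
  refine ⟨(APR.one_sub_le_measureReal_forall_abs_le (by omega) hδ hδ1 hsub hlaw hindep).trans
    (measureReal_mono fun w hw => ?_), ?_⟩
  · exact APR.exists_returns (hgaps.separates hδ hδ1 hw) hlam (hgaps.antitoneOn_pullBound hδ hδ1)
      (fun i hi hin => hgaps.one_le_pullBound hδ hδ1 hi hin) hβ hn
  · have hC : 0 ≤ 4 * (β ^ (3 + 4 * √(Real.logb β n)) / (β - 1)) := by
      have : 0 < β - 1 := sub_pos.2 hβ
      positivity
    refine (mul_le_mul_of_nonneg_left (hgaps.elimTime_pullBound_le hlam hδ hδ1) hC).trans_eq ?_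
    ring
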